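/- All words are over a countably infinite alphabet containing the distinct letters $x,y,h,t,t_1,t_2,\dots$; $1$ denotes the empty word, $|w|_z$ is the number of occurrences of the letter $z$ in the word $w$, and $\{x,y\}^+$ is the set of nonempty words in $x,y$. A monoid satisfies an identity $u\approx v$ if $\varphi(u)=\varphi(v)$ for every substitution $\varphi$ of its elements for the letters. A class of monoids is a variety if it is closed under homomorphic images, submonoids and arbitrary direct products; it is noncommutative if it contains a noncommutative monoid. It is defined by a set of identities if it consists of exactly the monoids satisfying all of them. Let $\mathbf O$ be the variety defined by $$xhxyxty\approx xhyxty,\qquad xhytxyx\approx xhytyx, \tag{1}$$ and let $\mathbf J_2$ be the variety defined by $x^3\approx x^2$ and $(xy)^2\approx(yx)^2$. Proposition. Every noncommutative subvariety of $\mathbf O\cap\mathbf J_2$ is defined by the two identities (1), the identities $x^3\approx x^2$ and $(xy)^2\approx(yx)^2$, and all identities in $\Sigma_1\cup\Sigma_2$, for some (possibly empty) set $$\Sigma_1\subseteq\{\,xhx\approx hx^2,\;\; x^2hx\approx x^2h,\;\; x^2hxtx\approx x^2htx,\;\; x^2hx\approx xhx\,\}$$ and some (possibly empty, possibly infinite)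 set $\Sigma_2$ of identities of the form $\mathbf h\mathbf p\mathbf c\approx\mathbf h\mathbf q\mathbf c$ such that * $\mathbf h\in\{1,\,yh\}$ and $\mathbf p,\mathbf q\in\{x,y\}^+$; * $\mathbf c$ is one of $1$, $\;txy$, $\;\prod_{i=1}^{m}(t_ia_i)$, $\;\prod_{i=2}^{m+1}(t_ia_i)$ with $m\ge 1$, where the products are taken in increasing order of $i$ and $(a_1,a_2,a_3,a_4,\dots)$ is the alternating sequence $(x,y,x,y,\dots)$; * $1\le|\mathbf p|_z=|\mathbf q|_z\le 2$ for each $z\in\{x,y\}$; * $|\mathbf h\mathbf p\mathbf c|_z=|\mathbf h\mathbf q\mathbf c|_z\ge 2$ for each $z\in\{x,y\}$. -/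

import Mathlib

universe u

namespace MonoidVar

/-- Words over a countably infinite alphabet, whose letters are indexed by `ℕ`;
the empty word is `1`. -/
abbrev Word : Type := FreeMonoid ℕ

/-- The identity `u ≈ v` is the pair `(u, v)`. -/
abbrev MIdentity : Type := Word × Word

/-- `M` satisfies `u ≈ v`: every substitution of elements of `M` for the letters gives both
words the same value. -/
def Satisfies (M : Type u) [Monoid M] (σ : MIdentity) : Prop :=
  ∀ φ : ℕ → M, FreeMonoid.lift φ σ.1 = FreeMonoid.lift φ σ.2

/-- A class of monoids. -/
abbrev MonoidClass : Type (u + 1) := ∀ (M : Type u) [Monoid M], Prop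

/-- The class `var Σ` of all monoids that satisfy every identity in `Σ`. -/
def varOf (S : Set MIdentity) : MonoidClass.{u} :=
  fun M _ => ∀ σ ∈ S, Satisfies M σ

/-- A variety of monoids: a class of monoids closed under homomorphic images, submonoids and
arbitrary direct products (the empty product makes it non-empty). -/
structure IsVariety (V : MonoidClass.{u}) : Prop where
  hom_image : ∀ (M N : Type u) [Monoid M] [Monoid N] (f : M →* N),
    Function.Surjective f → V M → V N
  submonoid : ∀ (M : Type u) [Monoid M] (S : Submonoid M), V M → V S
  product : ∀ (ι : Type u) (M : ι → Type u) [∀ i, Monoid (M i)],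
    (∀ i, V (M i)) → V (∀ i, M i)

/-- A class is commutative if all of its members are. -/
def IsCommutative (V : MonoidClass.{u}) : Prop :=
  ∀ (M : Type u) [Monoid M], V M → ∀ a b : M, a * b = b * a

/-! The distinct letters `x, y, h, t, t₁, t₂, …`. -/

def x : Word := FreeMonoid.of 0
def y : Word := FreeMonoid.of 1
def h : Word := FreeMonoid.of 2
def t : Word := FreeMonoid.of 3
def ti (i : ℕ) : Word := FreeMonoid.of (4 + i)

/-- `|w|_x`: the number of occurrences of the letter `x` in `w`. -/
def occX (w : Word) : ℕ := (FreeMonoid.toList w).count 0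

/-- `|w|_y`: the number of occurrences of the letter `y` in `w`. -/
def occY (w : Word) : ℕ := (FreeMonoid.toList w).count 1

/-- The identities `xhxyxty ≈ xhyxty` and `xhytxyx ≈ xhytyx`. -/
def idsO : Set MIdentity :=
  {(x * h * x * y * x * t * y, x * h * y * x * t * y),
   (x * h * y * t * x * y * x, x * h * y * t * y * x)}

/-- The identity `x ^ (n + 1) ≈ x ^ n`. -/
def aper (n : ℕ) : MIdentity := (x ^ (n + 1), x ^ n)

/-- The identity `(xy) ^ n ≈ (yx) ^ n`. -/
def evComm (n : ℕ) : MIdentity := ((x * y) ^ n, (y * x) ^ n)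

/-- The variety `O`. -/
def varO : MonoidClass.{u} := varOf idsO

/-- The variety `J_n`. -/
def varJ (n : ℕ) : MonoidClass.{u} := varOf {aper n, evComm n}

/-- The four identities `xhx ≈ hx²`, `x²hx ≈ x²h`, `x²hxtx ≈ x²htx`, `x²hx ≈ xhx`. -/
def idsFour : Set MIdentity :=
  {(x * h * x, h * x ^ 2),
   (x ^ 2 * h * x, x ^ 2 * h),
   (x ^ 2 * h * x * t * x, x ^ 2 * h * t * x),
   (x ^ 2 * h * x, x * h * x)}

/-- The alternating sequence `(a₁, a₂, a₃, a₄, …) = (x, y, x, y, …)`. -/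
def altLetter (i : ℕ) : Word := if Odd i then x else y

/-- The word `(t_s a_s) (t_{s+1} a_{s+1}) ⋯ (t_{s+m-1} a_{s+m-1})`, with `m` factors. -/
def altTail (s m : ℕ) : Word :=
  ((List.range' s m).map fun i => ti i * altLetter i).prod

/-- The tails `1`, `txy`, `∏_{i=1}^{m} t_i a_i` and `∏_{i=2}^{m+1} t_i a_i` with `m ≥ 1`. -/
def tails : Set Word :=
  {1, t * x * y} ∪ {c | ∃ m : ℕ, 1 ≤ m ∧ (c = altTail 1 m ∨ c = altTail 2 m)}

/-- The free semigroup `{x, y}⁺` inside the free monoid. -/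
def xyPlus : Set Word := {w | w ≠ 1 ∧ ∀ a ∈ FreeMonoid.toList w, a = 0 ∨ a = 1}

/-- The identities `hpc ≈ hqc` of restricted form; the head is `1` or `yh`. -/
def idsTail : Set MIdentity :=
  {σ | ∃ k p q c : Word,
    (k = 1 ∨ k = y * h) ∧ p ∈ xyPlus ∧ q ∈ xyPlus ∧ c ∈ tails ∧
    (1 ≤ occX p ∧ occX p = occX q ∧ occX q ≤ 2) ∧
    (1 ≤ occY p ∧ occY p = occY q ∧ occY q ≤ 2) ∧
    (occX (k * p * c) = occX (k * q * c) ∧ 2 ≤ occX (k * q * c)) ∧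
    (occY (k * p * c) = occY (k * q * c) ∧ 2 ≤ occY (k * q * c)) ∧
    σ = (k * p * c, k * q * c)}

end MonoidVar

/-! Let `W` be the class defined by the base identities together with the identities of the
restricted forms that hold in `V`. Then `V` is contained in `W`, and by Birkhoff's theorem
(`IsVariety.mem_of_identities`) equality follows once every identity u ≈ v of `V` is shown to hold
in `W` (`Approx.holds_of_holds`).

Noncommutativity forces u and v to have the same simple letters (those occurring once), in the same
order (`count_iff`, `simple_order`). These cut each word into blocks of repeated letters. The base
identities make letters that have already occurred commute, allow a non-first occurrence to be
doubled, and let it spread leftwards over repeated letters (`Base.comm`, `Base.dup`, `Base.spread`).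

Alignment. Fix a repeated letter z and read both words from the left. Where one word continues with
z and the other does not, deleting all letters except z and one or two simple letters yields, after
normalising exponents, an identity of Σ₁ that holds in `V`; such identities and the base ones
suffice to insert the missing z (`insertion`). Treating the letters one by one makes each letter
occur equally often in corresponding blocks (`align`).

Sorting. It remains to interchange adjacent repeated letters b, a of one word when a comes next in
the other word (`swap`). Keep only a and b in the prefix that ends with the current block. If some
later block contains both letters, the remainder collapses to txy; otherwise it collapses to an
alternating product. The prefixes can be cut down to at most two occurrences of each letter, so this
consequence is an identity of Σ₂ and holds in `W` (`tail_holds`, `pair`). Multiplying it on the left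
by the actual prefix and absorbing superfluous occurrences gives the interchange. As letters seen
earlier are absorbed in this way, the head yh is never needed. -/

namespace MonoidVar

/-! ### Words as lists, evaluation, and Birkhoff's theorem -/

/-- The value of the word `l` under the substitution `φ`. -/
def ev {M : Type u} [Monoid M] (φ : ℕ → M) (l : List ℕ) : M := (l.map φ).prod

section ev
variable {M : Type u} [Monoid M] (φ : ℕ → M)

@[simp] theorem ev_nil : ev φ [] = 1 := by simp [ev]
@[simp] theorem ev_cons (a : ℕ) (l : List ℕ) : ev φ (a :: l) = φ a * ev φ l := by simp [ev]
@[simp] theorem ev_append (l m : List ℕ) : ev φ (l ++ m) = ev φ l * ev φ m := by simp [ev]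

theorem ev_flatMap (f : ℕ → List ℕ) (l : List ℕ) :
    ev φ (l.flatMap f) = ev (fun n => ev φ (f n)) l := by
  induction l with
  | nil => simp
  | cons a l ih => simp [ih]

theorem lift_eq_ev (w : Word) : FreeMonoid.lift φ w = ev φ (FreeMonoid.toList w) := by
  simp [ev, FreeMonoid.lift_apply]

end ev

/-- Every monoid of the class `K` satisfies `u ≈ v`. -/
def Holds (K : MonoidClass.{u}) (u v : List ℕ) : Prop :=
  ∀ (M : Type u) [Monoid M], K M → ∀ φ : ℕ → M, ev φ u = ev φ v

theorem holds_iff (K : MonoidClass.{u}) (σ : MIdentity) :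
    (∀ (M : Type u) [Monoid M], K M → Satisfies M σ) ↔
      Holds K (FreeMonoid.toList σ.1) (FreeMonoid.toList σ.2) := by
  simp only [Holds, Satisfies, lift_eq_ev]

theorem Holds.symm {K : MonoidClass.{u}} {u v : List ℕ} (h : Holds K u v) : Holds K v u :=
  fun M _ hM φ => (h M hM φ).symm

theorem Holds.trans {K : MonoidClass.{u}} {u v w : List ℕ} (h : Holds K u v)
    (h' : Holds K v w) : Holds K u w :=
  fun M _ hM φ => (h M hM φ).trans (h' M hM φ)

theorem Holds.subst {K : MonoidClass.{u}} {u v : List ℕ} (h : Holds K u v)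
    (f : ℕ → List ℕ) : Holds K (u.flatMap f) (v.flatMap f) := by
  intro M _ hM φ
  rw [ev_flatMap, ev_flatMap]
  exact h M hM _

/-- Birkhoff's theorem: a monoid that satisfies all identities of a variety belongs to it. -/
theorem IsVariety.mem_of_identities {V : MonoidClass.{u}} (hV : IsVariety V) (M : Type u)
    [Monoid M] (hM : ∀ a b : List ℕ, Holds V a b → ∀ φ : ℕ → M, ev φ a = ev φ b) : V M := by
  classical
  -- Indexing the product by congruences instead of monoids keeps it in the universe `u`. The image
  -- of the free monoid in this product is the free object of `V` on the elements of `M`.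
  let ι : Type u := {c : Con (FreeMonoid M) // V c.Quotient}
  have hP : V (∀ i : ι, i.1.Quotient) := hV.product ι (fun i => i.1.Quotient) fun i => i.2
  let π : FreeMonoid M →* (∀ i : ι, i.1.Quotient) := MonoidHom.pi fun i => i.1.mk'
  have hS : V (MonoidHom.mrange π) := hV.submonoid _ _ hP
  let e : FreeMonoid M →* M := FreeMonoid.lift id
  have key : ∀ p q : FreeMonoid M, π p = π q → e p = e q := by
    intro p q hpq
    let L : List M := FreeMonoid.toList p ++ FreeMonoid.toList q
    -- Only finitely many elements of `M` occur in `p` and `q`; numbering them by position turns the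
    -- pair into an identity over `ℕ`. The default `1` is never used on `L`.
    let idx : M → ℕ := fun m => L.idxOf m
    let back : ℕ → M := fun n => L.getD n 1
    have hback : ∀ m ∈ L, back (idx m) = m := by
      intro m hm
      simp only [back, idx]
      rw [List.getD_eq_getElem _ _ (List.idxOf_lt_length_iff.2 hm)]
      simp
    have hh : Holds V ((FreeMonoid.toList p).map idx) ((FreeMonoid.toList q).map idx) := by
      intro N _ hN φ
      let ψ : FreeMonoid M →* N := FreeMonoid.lift (fun m => φ (idx m))
      have hr : V (MonoidHom.mrange ψ) := hV.submonoid _ _ hN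
      have hq : V (Con.ker ψ).Quotient :=
        hV.hom_image _ _ (Con.quotientKerEquivRange ψ).symm.toMonoidHom
          (Con.quotientKerEquivRange ψ).symm.surjective hr
      -- The coordinate at the kernel of `ψ` already shows that `ψ` identifies `p` and `q`.
      have h1 := congrFun hpq (⟨Con.ker ψ, hq⟩ : ι)
      have h2 : ψ p = ψ q := by
        have h3 : ((p : (Con.ker ψ).Quotient)) = q := h1
        exact (Con.ker_rel ψ).1 ((Con.eq _).1 h3)
      simpa [ψ, FreeMonoid.lift_apply, ev, Function.comp_def] using h2
    have h4 := hM _ _ hh back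
    have h5 : ∀ l : List M, (∀ m ∈ l, m ∈ L) → ev back (l.map idx) = l.prod := by
      intro l hl
      induction l with
      | nil => simp
      | cons m l ih =>
        simp only [List.map_cons, ev_cons, List.prod_cons]
        rw [hback m (hl m (by simp)), ih fun k hk => hl k (by simp [hk])]
    rw [h5 _ fun m hm => by simp [L, hm], h5 _ fun m hm => by simp [L, hm]] at h4
    simpa [e, FreeMonoid.lift_apply] using h4
  have hex : ∀ s : MonoidHom.mrange π, ∃ p : FreeMonoid M, π p = s := fun s => s.2
  choose g hg using hex
  let f : MonoidHom.mrange π →* M :=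
    { toFun := fun s => e (g s)
      map_one' := by rw [key (g 1) 1 (by rw [hg]; simp)]; simp
      map_mul' := fun s s' => by
        rw [key (g (s * s')) (g s * g s') (by rw [hg, map_mul, hg, hg]; rfl), map_mul] }
  refine hV.hom_image _ _ f (fun m => ⟨⟨π (FreeMonoid.of m), ⟨_, rfl⟩⟩, ?_⟩) hS
  change e (g _) = m
  rw [key _ (FreeMonoid.of m) (hg _)]
  simp [e]

/-! ### Consequences of the identities of O ∩ J₂ -/

/-- `M` satisfies the identities of `O ∩ J₂`. -/
structure Base (M : Type u) [Monoid M] : Prop where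
  left : ∀ x h y t : M, x * h * x * y * x * t * y = x * h * y * x * t * y
  right : ∀ x h y t : M, x * h * y * t * x * y * x = x * h * y * t * y * x
  sq_comm : ∀ x y : M, x * y * (x * y) = y * x * (y * x)

/-- `x` is a factor of `g`. -/
def Has {M : Type u} [Monoid M] (x g : M) : Prop := ∃ a b, g = a * x * b

section Has
variable {M : Type u} [Monoid M]

theorem Has.mul_right {x g : M} (h : Has x g) (k : M) : Has x (g * k) := by
  obtain ⟨a, b, rfl⟩ := h
  exact ⟨a, b * k, by simp [mul_assoc]⟩

theorem Has.mul_left {x g : M} (h : Has x g) (k : M) : Has x (k * g) := by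
  obtain ⟨a, b, rfl⟩ := h
  exact ⟨k * a, b, by simp [mul_assoc]⟩

theorem Has.self (x : M) : Has x x := ⟨1, 1, by simp⟩

theorem has_ev (φ : ℕ → M) {z : ℕ} {l : List ℕ} (h : z ∈ l) : Has (φ z) (ev φ l) := by
  obtain ⟨s, t, rfl⟩ := List.append_of_mem h
  exact ⟨ev φ s, ev φ t, by simp [mul_assoc]⟩

end Has

namespace Base
variable {M : Type u} [Monoid M] (hM : Base M)
include hM

/-- This is `left` with y = t = 1. It contains x³ ≈ x², so `Base` need not list that identity. -/
theorem dup {x g : M} (hx : Has x g) : g * x * x = g * x := by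
  obtain ⟨a, b, rfl⟩ := hx
  have := hM.left x b 1 1
  simp only [mul_one] at this
  simp only [mul_assoc] at this ⊢
  rw [this]

/-- Covers a `y` that need not have occurred before but recurs later; `spread_second` covers a `y`
that has already occurred. -/
theorem spread_first {x y g r : M} (hx : Has x g) (hy : Has y r) :
    g * y * x * r = g * x * y * x * r := by
  obtain ⟨a, b, rfl⟩ := hx
  obtain ⟨c, d, rfl⟩ := hy
  have := congrArg (fun k => a * k * d) (hM.left x b y c)
  simp only [mul_assoc] at this ⊢
  rw [this]

/-- Once each of the two letters spreads over the other, g·xy = g·(xy)² and g·yx = g·(yx)², and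
`sq_comm` identifies these. The identity `right` gives one direction of spreading at once; the other
goes through g·yyx. -/
theorem comm_of_ordered {x y g : M} (hx : Has x g) (hy : Has y g)
    (hxy : ∃ a b c, g = a * x * b * y * c) : g * x * y = g * y * x := by
  have ordered : ∀ {x y : M}, (∃ a b c, g = a * x * b * y * c) → g * y * x = g * x * y * x := by
    rintro x y ⟨a, b, c, rfl⟩
    have := congrArg (fun k => a * k) (hM.right x b y c)
    simp only [mul_assoc] at this ⊢
    exact this.symm
  -- a letter spreads over another one even if its first occurrence is the later one
  have spread : ∀ {x y : M}, Has x g → Has y g → (∃ a b c, g = a * y * b * x * c) →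
      g * y * x = g * x * y * x := by
    intro x y hx hy hyx
    have e1 : g * x * y * x = g * y * x * y * x := by rw [ordered hyx]
    have e2 : g * y * y * x = g * y * x * y * x := by
      obtain ⟨a, b, rfl⟩ := hx
      have := congrArg (fun k => a * k) (hM.right x b y 1)
      simp only [mul_assoc, mul_one] at this ⊢
      exact this.symm
    rw [e1, ← e2, hM.dup hy]
  have s1 : g * y * x = g * x * y * x := ordered hxy
  have s2 : g * x * y = g * y * x * y := spread hy hx hxy
  have e : g * (x * y * (x * y)) = g * (y * x * (y * x)) := by rw [hM.sq_comm]
  have e1 : g * (x * y * (x * y)) = g * x * y := by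
    rw [show g * (x * y * (x * y)) = g * x * y * x * y by simp only [mul_assoc], ← s1, ← s2]
  have e2 : g * (y * x * (y * x)) = g * y * x := by
    rw [show g * (y * x * (y * x)) = g * y * x * y * x by simp only [mul_assoc], ← s2, ← s1]
  rw [← e1, e, e2]

theorem comm {x y g : M} (hx : Has x g) (hy : Has y g) : g * x * y = g * y * x := by
  have half : ∀ {x y : M}, Has x g → Has y g → g * x * y = g * x * y * x := by
    intro x y hx hy
    obtain ⟨c, d, hg⟩ := id hy
    -- As factors of an element, `x` and `y` may overlap in `g`, so neither need precede the other.
    -- Appending `x` to `g` creates an occurrence of `y` followed by one of `x`.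
    have := hM.comm_of_ordered (hy.mul_right x) (hx.mul_right x) ⟨c, d, 1, by rw [hg, mul_one]⟩
    rw [this, hM.dup hx]
  have e : g * (x * y * (x * y)) = g * (y * x * (y * x)) := by rw [hM.sq_comm]
  have e' : ∀ {x y : M}, Has x g → Has y g → g * (x * y * (x * y)) = g * x * y := by
    intro x y hx hy
    rw [show g * (x * y * (x * y)) = g * x * y * x * y by simp only [mul_assoc], ← half hx hy,
      hM.dup (hy.mul_right x)]
  rw [← e' hx hy, e, e' hy hx]

theorem spread_second {x y g : M} (hx : Has x g) (hy : Has y g) :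
    g * y * x = g * x * y * x := by
  rw [hM.comm hx hy, hM.dup (hx.mul_right y)]

variable (φ : ℕ → M)

/-- A letter that has occurred before spreads to the left over repeated letters. -/
theorem spread {P s r : List ℕ} {z : ℕ} (hz : z ∈ P)
    (hs : ∀ c ∈ s, 2 ≤ (P ++ s ++ z :: r).count c) :
    ev φ (P ++ s ++ z :: r) = ev φ (P ++ z :: s ++ z :: r) := by
  induction s using List.reverseRecOn generalizing P r with
  | nil =>
    have := hM.dup (has_ev φ hz)
    simp only [List.append_nil, ev_append, ev_cons, List.append_assoc, List.cons_append,
      List.nil_append, ← mul_assoc, this]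
  | append_singleton s c ih =>
    have one : ∀ P' : List ℕ, z ∈ P' → (c ∈ P' ∨ c ∈ r) →
        ev φ (P' ++ c :: z :: r) = ev φ (P' ++ z :: c :: z :: r) := by
      intro P' hz' hc
      simp only [ev_append, ev_cons, ← mul_assoc]
      rcases hc with hc | hc
      · rw [hM.spread_second (has_ev φ hz') (has_ev φ hc)]
      · exact hM.spread_first (has_ev φ hz') (has_ev φ hc)
    -- The other occurrence of `c` lies either before or after; this decides which of the two
    -- spreading rules applies.
    have hc : c ∈ P ++ s ∨ c ∈ r := by
      by_contra hcon
      simp only [List.mem_append, not_or] at hcon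
      have h2 := hs c (by simp)
      have hcz : z ≠ c := fun h => hcon.1.1 (h ▸ hz)
      simp [List.count_append, List.count_eq_zero_of_not_mem hcon.1.1,
        List.count_eq_zero_of_not_mem hcon.1.2, List.count_eq_zero_of_not_mem hcon.2, hcz] at h2
    have e1 := one (P ++ s) (by simp [hz]) hc
    have e2 := ih (P := P) (r := c :: z :: r) hz (by
      intro d hd
      refine (hs d (by simp [hd])).trans ?_
      simp only [List.count_append, List.count_cons, List.count_nil]
      omega)
    have e3 := one (P ++ z :: s) (by simp) (by
      rcases hc with hc | hc
      · left; simp only [List.mem_append, List.mem_cons] at hc ⊢; tauto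
      · exact Or.inr hc)
    calc ev φ (P ++ (s ++ [c]) ++ z :: r) = ev φ (P ++ s ++ c :: z :: r) := by simp
      _ = _ := e1
      _ = _ := e2
      _ = _ := by rw [← e3]; simp

/-- A repeated letter that occurs again may be deleted from a stretch of repeated letters. -/
theorem delete {P m s r : List ℕ} {z : ℕ} (hz : z ∈ P)
    (hs : ∀ c ∈ m ++ s, 2 ≤ (P ++ m.filter (· ≠ z) ++ s ++ z :: r).count c) :
    ev φ (P ++ m ++ s ++ z :: r) = ev φ (P ++ m.filter (· ≠ z) ++ s ++ z :: r) := by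
  induction m generalizing P with
  | nil => simp
  | cons c m ih =>
    by_cases hc : c = z
    · subst hc
      have h1 := ih (P := P ++ [c]) (by simp) (by
        intro d hd
        refine (hs d (by simp only [List.mem_append, List.mem_cons] at hd ⊢; tauto)).trans ?_
        simp [List.count_append, List.count_cons])
      -- The leading occurrence is kept while the rest of `m` is cleaned, and is then removed by
      -- `spread` read from right to left.
      have h2 := hM.spread φ (P := P) (s := m.filter (· ≠ c) ++ s) (r := r) hz (by
        intro d hd
        refine (hs d ?_).trans ?_
        · simp only [List.mem_append, List.mem_filter, List.mem_cons] at hd ⊢; tauto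
        · simp [List.count_append, List.count_cons])
      simp only [List.append_assoc, List.cons_append, List.nil_append, ne_eq, decide_not,
        decide_true, Bool.not_true, Bool.false_eq_true,
        not_false_eq_true, List.filter_cons_of_neg] at h1 h2 ⊢
      rw [h1, ← h2]
    · have h1 := ih (P := P ++ [c]) (by simp [hz]) (by
        intro d hd
        refine (hs d (by simp only [List.mem_append, List.mem_cons] at hd ⊢; tauto)).trans ?_
        simp [List.count_append, List.count_cons, hc])
      simpa [hc] using h1

theorem comm_word {P m : List ℕ} {z : ℕ} (hz : z ∈ P) (hm : ∀ c ∈ m, c ∈ P) :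
    ev φ P * ev φ m * φ z = ev φ P * φ z * ev φ m := by
  induction m using List.reverseRecOn with
  | nil => simp
  | append_singleton m c ih =>
    have h1 := ih fun d hd => hm d (by simp [hd])
    have h2 := hM.comm (g := ev φ (P ++ m)) (has_ev φ (z := z) (by simp [hz]))
      (has_ev φ (z := c) (by simp [hm c]))
    simp only [ev_append, ev_cons, ev_nil, mul_one, ← mul_assoc] at h1 h2 ⊢
    rw [← h2, h1]

theorem absorb {P m : List ℕ} {z : ℕ} (hz : z ∈ m) (hm : ∀ c ∈ m, c ∈ P) :
    ev φ P * ev φ m * φ z = ev φ P * ev φ m := by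
  obtain ⟨m₁, m₂, rfl⟩ := List.append_of_mem hz
  have h1 := hM.comm_word φ (P := P ++ m₁ ++ [z]) (m := m₂) (z := z) (by simp) (by
    intro c hc
    have := hm c (by simp [hc])
    simp [this])
  have h2 := hM.dup (g := ev φ (P ++ m₁)) (has_ev φ (z := z) (by simp [hm z]))
  simp only [ev_append, ev_cons, ev_nil, mul_one, ← mul_assoc] at h1 h2 ⊢
  rw [h1, h2]

/-- A word of repeated letters only matters through its content. -/
theorem eq_two {P m : List ℕ} {a b : ℕ} (ha : a ∈ m) (hb : b ∈ m) (hm : ∀ c ∈ m, c = a ∨ c = b)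
    (haP : a ∈ P) (hbP : b ∈ P) : ev φ P * ev φ m = ev φ P * φ a * φ b := by
  have hmP : ∀ c ∈ m, c ∈ P := fun c hc => by rcases hm c hc with rfl | rfl <;> assumption
  rw [← hM.absorb φ ha hmP, hM.comm_word φ haP hmP]
  have h1 := hM.absorb φ hb (P := P ++ [a]) (by intro c hc; simp [hmP c hc])
  have h2 := hM.comm_word φ (P := P ++ [a]) (m := m) (z := b) (by simp [hbP])
    (by intro c hc; simp [hmP c hc])
  simp only [ev_append, ev_cons, ev_nil, mul_one] at h1 h2
  rw [← h1, h2]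
  -- One `a` and one `b` now stand in front of `m`, and it remains to absorb `m` letter by letter.
  -- The membership facts must go, since they do not pass to tails of `m`.
  clear h1 h2 ha hb
  induction m with
  | nil => simp
  | cons c m ih =>
    have ih := ih (fun d hd => hm d (by simp [hd])) (fun d hd => hmP d (by simp [hd]))
    have hb' := has_ev φ hbP
    have ha' := has_ev φ haP
    rw [ev_cons, ← mul_assoc]
    rcases hm c (by simp) with rfl | rfl
    · rw [hM.comm ((Has.self (φ c)).mul_left _ |>.mul_right 1 |> fun h => by simpa using h)
        (hb'.mul_right _) |>.symm, hM.dup ha', ih]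
    · rw [hM.dup (hb'.mul_right _), ih]

end Base

/-! ### The identities of Σ₁, the tails, and the approximating class -/

/-- `xhx ≈ hx²`. -/
def Id₁ (M : Type u) [Monoid M] : Prop := ∀ x h : M, x * h * x = h * x * x
/-- `x²hx ≈ x²h`. -/
def Id₂ (M : Type u) [Monoid M] : Prop := ∀ x h : M, x * x * h * x = x * x * h
/-- `x²hxtx ≈ x²htx`. -/
def Id₃ (M : Type u) [Monoid M] : Prop :=
  ∀ x h t : M, x * x * h * x * t * x = x * x * h * t * x
/-- `x²hx ≈ xhx`. -/
def Id₄ (M : Type u) [Monoid M] : Prop := ∀ x h : M, x * x * h * x = x * h * x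

/-- `altTail s m` as a list of letters. -/
def altList (s m : ℕ) : List ℕ :=
  (List.range' s m).flatMap fun i => [4 + i, if Odd i then 0 else 1]

/-- The words of `tails` as lists of letters. -/
def IsTail (c : List ℕ) : Prop :=
  c = [3, 0, 1] ∨ ∃ s m, (s = 1 ∨ s = 2) ∧ c = altList s m

/-- `W` is a subclass of `O ∩ J₂` containing the noncommutative class `V`, and it satisfies the
identities of the two special forms that hold in `V`. -/
structure Approx (V W : MonoidClass.{u}) : Prop where
  base : ∀ (M : Type u) [Monoid M], W M → Base M
  le : ∀ (M : Type u) [Monoid M], V M → W M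
  id₁ : (∀ (M : Type u) [Monoid M], V M → Id₁ M) → ∀ (M : Type u) [Monoid M], W M → Id₁ M
  id₂ : (∀ (M : Type u) [Monoid M], V M → Id₂ M) → ∀ (M : Type u) [Monoid M], W M → Id₂ M
  id₃ : (∀ (M : Type u) [Monoid M], V M → Id₃ M) → ∀ (M : Type u) [Monoid M], W M → Id₃ M
  id₄ : (∀ (M : Type u) [Monoid M], V M → Id₄ M) → ∀ (M : Type u) [Monoid M], W M → Id₄ M
  tail : ∀ p q c : List ℕ, (∀ z ∈ p, z = 0 ∨ z = 1) → (∀ z ∈ q, z = 0 ∨ z = 1) → IsTail c →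
    (∀ z, z = 0 ∨ z = 1 →
      1 ≤ p.count z ∧ p.count z = q.count z ∧ q.count z ≤ 2 ∧ 2 ≤ (q ++ c).count z) →
    Holds V (p ++ c) (q ++ c) → Holds W (p ++ c) (q ++ c)
  noncomm : ¬ Holds V [0, 1] [1, 0]

/-! ### Restrictions of words and invariants of the identities of V -/

/-- The restriction of a word to the letters in `A`. -/
def res (A : Finset ℕ) (l : List ℕ) : List ℕ := l.filter (· ∈ A)

section res
variable (A : Finset ℕ)

@[simp] theorem res_nil : res A [] = [] := rfl

@[simp] theorem res_append (l m : List ℕ) : res A (l ++ m) = res A l ++ res A m :=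
  List.filter_append ..

theorem res_cons_of_mem {A : Finset ℕ} {c : ℕ} (h : c ∈ A) (l : List ℕ) :
    res A (c :: l) = c :: res A l := by simp [res, h]

theorem res_cons_of_notMem {A : Finset ℕ} {c : ℕ} (h : c ∉ A) (l : List ℕ) :
    res A (c :: l) = res A l := by simp [res, h]

@[simp] theorem mem_res {A : Finset ℕ} {c : ℕ} {l : List ℕ} : c ∈ res A l ↔ c ∈ l ∧ c ∈ A := by
  simp [res]

theorem count_res {A : Finset ℕ} {c : ℕ} (h : c ∈ A) (l : List ℕ) :
    (res A l).count c = l.count c := by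
  simp [res, List.count_filter, h]

theorem res_eq_nil {A : Finset ℕ} {l : List ℕ} (h : ∀ c ∈ l, c ∉ A) : res A l = [] := by
  simpa [res] using h

theorem res_res {A B : Finset ℕ} (h : A ⊆ B) (l : List ℕ) : res A (res B l) = res A l := by
  simp only [res, List.filter_filter]
  congr 1
  funext c
  by_cases hc : c ∈ A <;> simp [hc]
  exact h hc

theorem res_mono {A B : Finset ℕ} (h : A ⊆ B) {l m : List ℕ} (e : res B l = res B m) :
    res A l = res A m := by
  rw [← res_res h, e, res_res h]

theorem ev_res {M : Type u} [Monoid M] (φ : ℕ → M) {A : Finset ℕ} (l : List ℕ)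
    (h : ∀ c, c ∉ A → φ c = 1) : ev φ (res A l) = ev φ l := by
  induction l with
  | nil => rfl
  | cons c l ih =>
    by_cases hc : c ∈ A
    · rw [res_cons_of_mem hc, ev_cons, ev_cons, ih]
    · rw [res_cons_of_notMem hc, ev_cons, ih, h c hc, one_mul]

end res

theorem ev_eq_pow {M : Type u} [Monoid M] (φ : ℕ → M) {z : ℕ} {l : List ℕ}
    (h : ∀ c ∈ l, c ≠ z → φ c = 1) : ev φ l = φ z ^ l.count z := by
  induction l with
  | nil => simp
  | cons c l ih =>
    rw [ev_cons, ih fun d hd => h d (by simp [hd])]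
    by_cases hc : c = z
    · subst hc; simp [pow_succ']
    · simp [h c (by simp) hc, hc]

theorem list_eq_of_pairs {l m : List ℕ} (h : ∀ a b, res {a, b} l = res {a, b} m) : l = m := by
  induction l generalizing m with
  | nil =>
    cases m with
    | nil => rfl
    | cons c m => simpa [res] using h c c
  | cons a l ih =>
    cases m with
    | nil => simpa [res] using h a a
    | cons b m =>
      have hab : a = b := by
        have := h a b
        rw [res_cons_of_mem (by simp), res_cons_of_mem (by simp)] at this
        exact (List.cons.inj this).1
      subst hab
      congr 1
      refine ih fun c d => ?_
      have := h c d
      by_cases hc : a ∈ ({c, d} : Finset ℕ)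
      · rw [res_cons_of_mem hc, res_cons_of_mem hc] at this
        exact (List.cons.inj this).2
      · rwa [res_cons_of_notMem hc, res_cons_of_notMem hc] at this

namespace Base
variable {M : Type u} [Monoid M] (hM : Base M)
include hM

theorem dup_pow {x g : M} (hx : Has x g) (n : ℕ) : g * x ^ (n + 1) = g * x := by
  induction n with
  | zero => simp
  | succ n ih => rw [pow_succ, ← mul_assoc, ih, hM.dup hx]

theorem pow_eq (x : M) (n : ℕ) : x ^ (n + 2) = x * x := by
  rw [pow_succ', hM.dup_pow (Has.self x)]

end Base

theorem Holds.count_pow {V : MonoidClass.{u}} {u v : List ℕ} (h : Holds V u v) (z : ℕ) (M : Type u) [Monoid M] (hM : V M)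
    (x : M) : x ^ u.count z = x ^ v.count z := by
  have := h M hM (fun n => if n = z then x else 1)
  rw [ev_eq_pow _ (z := z) (fun c _ hc => by simp [hc]),
    ev_eq_pow _ (z := z) (fun c _ hc => by simp [hc])] at this
  simpa using this

namespace Approx
variable {V W : MonoidClass.{u}} (hVW : Approx V W)
include hVW

theorem baseV (M : Type u) [Monoid M] (h : V M) : Base M := hVW.base M (hVW.le M h)

theorem holds_le {u v : List ℕ} (h : Holds W u v) : Holds V u v :=
  fun M _ hM φ => h M (hVW.le M hM) φ

theorem not_comm : ¬ ∀ (M : Type u) [Monoid M], V M → ∀ x y : M, x * y = y * x := by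
  intro h
  exact hVW.noncomm fun M _ hM φ => by simpa using h M hM (φ 0) (φ 1)

/-- Idempotency would give xy = (xy)² = (yx)² = yx. -/
theorem not_idem : ¬ ∀ (M : Type u) [Monoid M], V M → ∀ x : M, x = x * x := by
  intro h
  refine hVW.not_comm fun M _ hM x y => ?_
  rw [h M hM (x * y), (hVW.baseV M hM).sq_comm, ← h M hM (y * x)]

theorem not_pow {j k : ℕ} (hjk : j < k) (hj : j ≤ 1) :
    ¬ ∀ (M : Type u) [Monoid M], V M → ∀ x : M, x ^ j = x ^ k := by
  intro h
  refine hVW.not_idem fun M _ hM x => ?_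
  have hx := h M hM x
  have hp := (hVW.baseV M hM).pow_eq x
  have h3 : x * x * x = x * x := (hVW.baseV M hM).dup (Has.self x)
  -- If 1 = x^k with k ≥ 2, then x² = 1, and x³ = x² forces x = 1. If x = x^k with k ≥ 2, the right
  -- side is x².
  obtain rfl | rfl : j = 0 ∨ j = 1 := by omega
  · obtain _ | _ | k := k
    · omega
    · have : x = 1 := by simpa using hx.symm
      simp [this]
    · rw [hp, pow_zero] at hx
      rw [← hx, one_mul] at h3
      rw [← hx, h3]
  · obtain _ | _ | k := k
    · omega
    · omega
    · rw [hp] at hx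
      simpa using hx

/-- Mapping all other letters to 1 leaves an equality of powers, and by `not_pow` the exponents can
differ only when both are at least 2. -/
theorem count_iff {u v : List ℕ} (h : Holds V u v) (z : ℕ) :
    u.count z = v.count z ∨ 2 ≤ u.count z ∧ 2 ≤ v.count z := by
  by_contra hcon
  rcases lt_or_ge (u.count z) (v.count z) with hlt | hge
  · exact hVW.not_pow hlt (by omega) fun M _ hM x => h.count_pow z M hM x
  · exact hVW.not_pow (j := v.count z) (k := u.count z) (by omega) (by omega)
      fun M _ hM x => (h.count_pow z M hM x).symm

/-- If two simple letters came in different orders, erasing everything else would leave xy ≈ yx. -/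
theorem simple_order {u v : List ℕ} (h : Holds V u v) {T : Finset ℕ}
    (hu : ∀ t ∈ T, u.count t = 1) (hv : ∀ t ∈ T, v.count t = 1) : res T u = res T v := by
  refine list_eq_of_pairs fun s t => ?_
  have single : ∀ {l : List ℕ} {s : ℕ}, l.count s = 1 → res {s} l = [s] := by
    intro l s hs
    have : res {s} l = List.replicate (l.count s) s := by
      rw [List.eq_replicate_iff]
      refine ⟨?_, by simp⟩
      simp only [res, Finset.mem_singleton]
      rw [List.count_eq_length_filter]
      congr 1
    rw [this, hs]; rfl
  have red : ∀ l, res {s, t} (res T l) = res ({s, t} ∩ T) l := by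
    intro l
    simp only [res, List.filter_filter]
    congr 1
    funext c
    simp
  rw [red, red]
  by_cases hs : s ∈ T <;> by_cases ht : t ∈ T
  · rw [Finset.inter_eq_left.2 (by simp [Finset.insert_subset_iff, hs, ht])]
    by_cases hst : s = t
    · subst hst
      rw [Finset.pair_eq_singleton, single (hu s hs), single (hv s hs)]
    have two : ∀ {l : List ℕ}, l.count s = 1 → l.count t = 1 →
        res {s, t} l = [s, t] ∨ res {s, t} l = [t, s] := by
      intro l h1 h2
      have h1' := count_res (A := {s, t}) (c := s) (by simp) l
      have h2' := count_res (A := {s, t}) (c := t) (by simp) l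
      have hm : ∀ c ∈ res {s, t} l, c = s ∨ c = t := by simp
      rw [h1] at h1'
      rw [h2] at h2'
      have hl : (res {s, t} l).Perm [s, t] := by
        rw [List.perm_iff_count]
        intro c
        by_cases hcs : c = s
        · subst hcs; rw [h1']; simp [hst]
        · by_cases hct : c = t
          · subst hct; rw [h2']; simp [hst, hcs]
          · rw [List.count_eq_zero_of_not_mem (fun hc => (hm c hc).elim hcs hct),
              List.count_eq_zero_of_not_mem (by simp [hcs, hct])]
      generalize res {s, t} l = k at hl
      have hlen := hl.length_eq
      match k, hlen with
      | [c, d], _ =>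
        rcases (by simpa using hl.mem_iff.1 (List.mem_cons_self (a := c)) : c = s ∨ c = t)
          with rfl | rfl
        · exact Or.inl (by simpa using hl)
        · exact Or.inr (by simpa using hl.trans (List.Perm.swap _ _ _))
    have bad : ∀ {u v : List ℕ}, Holds V u v → res {s, t} u = [s, t] →
        res {s, t} v = [t, s] → False := by
      intro u v h h1 h2
      refine hVW.not_comm fun M _ hM x y => ?_
      have := h M hM (fun n => if n = s then x else if n = t then y else 1)
      rw [← ev_res (A := {s, t}) _ u (by simp +contextual), h1,
        ← ev_res (A := {s, t}) _ v (by simp +contextual), h2] at this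
      simpa [Ne.symm hst] using this
    rcases two (hu s hs) (hu t ht) with h1 | h1 <;> rcases two (hv s hs) (hv t ht) with h2 | h2
    · rw [h1, h2]
    · exact (bad h h1 h2).elim
    · exact (bad h.symm h2 h1).elim
    · rw [h1, h2]
  · rw [show ({s, t} ∩ T : Finset ℕ) = {s} by
      ext c; simp only [Finset.mem_inter, Finset.mem_insert, Finset.mem_singleton]
      constructor
      · rintro ⟨rfl | rfl, hc⟩
        · rfl
        · exact absurd hc ht
      · rintro rfl; exact ⟨Or.inl rfl, hs⟩, single (hu s hs), single (hv s hs)]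
  · rw [show ({s, t} ∩ T : Finset ℕ) = {t} by
      ext c; simp only [Finset.mem_inter, Finset.mem_insert, Finset.mem_singleton]
      constructor
      · rintro ⟨rfl | rfl, hc⟩
        · exact absurd hc hs
        · rfl
      · rintro rfl; exact ⟨Or.inr rfl, ht⟩, single (hu t ht), single (hv t ht)]
  · rw [show ({s, t} ∩ T : Finset ℕ) = ∅ by
      ext c; simp only [Finset.mem_inter, Finset.mem_insert, Finset.mem_singleton]
      constructor
      · rintro ⟨rfl | rfl, hc⟩ <;> contradiction
      · simp]
    simp [res]

end Approx

/-! ### Aligning a repeated letter with the simple letters -/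

theorem exists_last {z : ℕ} {l : List ℕ} (h : z ∈ l) : ∃ l₁ l₂, l = l₁ ++ z :: l₂ ∧ z ∉ l₂ := by
  obtain ⟨a, b, hab, ha⟩ := List.eq_append_cons_of_mem (List.mem_reverse.2 h)
  exact ⟨b.reverse, a.reverse, by simpa using congrArg List.reverse hab, by simpa using ha⟩

theorem exists_first {z : ℕ} {l : List ℕ} (h : z ∈ l) : ∃ l₁ l₂, l = l₁ ++ z :: l₂ ∧ z ∉ l₁ :=
  List.eq_append_cons_of_mem h

/-- The substitution that only keeps the letters `z`, `s` and `t`. -/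
def keep {M : Type u} [Monoid M] (z s t : ℕ) (x h k : M) (n : ℕ) : M :=
  if n = z then x else if n = s then h else if n = t then k else 1

theorem ev_keep_of_notMem {M : Type u} [Monoid M] {z s t : ℕ} {x h k : M} {l : List ℕ}
    (hs : s ∉ l ∨ h = 1) (ht : t ∉ l ∨ k = 1) : ev (keep z s t x h k) l = x ^ l.count z := by
  rw [ev_eq_pow _ (z := z)]
  · simp [keep]
  · intro c hc hcz
    simp only [keep, hcz, if_false]
    split_ifs with h1 h2
    · subst h1; exact hs.resolve_left (not_not.2 hc)
    · subst h2; exact ht.resolve_left (not_not.2 hc)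
    · rfl

namespace Approx
variable {V W : MonoidClass.{u}} (hVW : Approx V W)
include hVW

/-- Deleting letters from an identity of `V` leaves exponents that are not under control. This lemma
and the next three normalise them: multiplication by x where needed produces repeated occurrences,
whose exponents collapse by `dup_pow` and `pow_eq`. -/
theorem id₁_of {a j l : ℕ} (ha : 1 ≤ a) (haj : 2 ≤ a + j) (hl : 2 ≤ l)
    (h : ∀ (M : Type u) [Monoid M], V M → ∀ x h : M, x ^ a * h * x ^ j = h * x ^ l) :
    ∀ (M : Type u) [Monoid M], W M → Id₁ M := by
  refine hVW.id₁ fun M _ hM x h' => ?_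
  have B := hVW.baseV M hM
  have e := h M hM x h'
  obtain ⟨l, rfl⟩ := Nat.exists_eq_add_of_le' hl
  obtain ⟨a, rfl⟩ := Nat.exists_eq_add_of_le' ha
  have hx := Has.self x
  rw [B.pow_eq] at e
  rcases a with _ | a
  · obtain ⟨j, rfl⟩ : ∃ i, j = i + 1 := ⟨j - 1, by omega⟩
    rw [B.dup_pow ((hx.mul_right h').mul_left (x ^ 0) |> fun h => by simpa using h)] at e
    simpa [mul_assoc] using e
  · rw [B.pow_eq] at e
    have e2 : x * h' * x = x * x * h' * x ^ j := by
      have h3 := congrArg (x * ·) e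
      simp only [← mul_assoc] at h3
      rw [B.dup (hx.mul_right h'), B.dup hx] at h3
      exact h3.symm
    rw [e2, e, mul_assoc]

theorem id₂_of {a i : ℕ} (ha : 2 ≤ a) (hi : 1 ≤ i)
    (h : ∀ (M : Type u) [Monoid M], V M → ∀ x h : M, x ^ a * h * x ^ i = x ^ a * h) :
    ∀ (M : Type u) [Monoid M], W M → Id₂ M := by
  refine hVW.id₂ fun M _ hM x h' => ?_
  have B := hVW.baseV M hM
  have e := h M hM x h'
  obtain ⟨a, rfl⟩ := Nat.exists_eq_add_of_le' ha
  obtain ⟨i, rfl⟩ := Nat.exists_eq_add_of_le' hi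
  rw [B.pow_eq, B.dup_pow (((Has.self x).mul_right x).mul_right h')] at e
  exact e

theorem id₃_of {a i j l : ℕ} (ha : 1 ≤ a) (hi : 1 ≤ i)
    (h : ∀ (M : Type u) [Monoid M], V M →
      ∀ x h k : M, x ^ a * h * x ^ i * k * x ^ j = x ^ a * h * k * x ^ l) :
    ∀ (M : Type u) [Monoid M], W M → Id₃ M := by
  refine hVW.id₃ fun M _ hM x h' k => ?_
  have B := hVW.baseV M hM
  have e := congrArg (fun g => x * (g * x)) (h M hM x h' k)
  obtain ⟨a, rfl⟩ := Nat.exists_eq_add_of_le' ha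
  obtain ⟨i, rfl⟩ := Nat.exists_eq_add_of_le' hi
  have hx := Has.self x
  have e1 : x * x ^ (a + 1) = x * x := B.dup_pow hx a
  have e2 : x * x * h' * x ^ (i + 1) = x * x * h' * x :=
    B.dup_pow ((hx.mul_right x).mul_right h') i
  simp only [← mul_assoc] at e
  rw [e1, e2, mul_assoc (x * x * h' * x * k), ← pow_succ, mul_assoc (x * x * h' * k), ← pow_succ,
    B.dup_pow ((((hx.mul_right x).mul_right h').mul_right x).mul_right k),
    B.dup_pow (((hx.mul_right x).mul_right h').mul_right k)] at e
  exact e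

theorem id₄_of {a j l : ℕ} (ha : 2 ≤ a)
    (h : ∀ (M : Type u) [Monoid M], V M → ∀ x h : M, x ^ a * h * x ^ j = x * h * x ^ l) :
    ∀ (M : Type u) [Monoid M], W M → Id₄ M := by
  refine hVW.id₄ fun M _ hM x h' => ?_
  have B := hVW.baseV M hM
  have e := congrArg (· * x) (h M hM x h')
  obtain ⟨a, rfl⟩ := Nat.exists_eq_add_of_le' ha
  have hx := Has.self x
  rw [B.pow_eq, mul_assoc, ← pow_succ, mul_assoc (x * h'), ← pow_succ,
    B.dup_pow ((hx.mul_right x).mul_right h'), B.dup_pow (hx.mul_right h')] at e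
  exact e

/-- If `u` and `v` restricted to `z` and the simple letters agree up to some point, where `u`
continues with `z` and `v` does not, then `z` may be inserted into `v`. -/
theorem insertion {T : Finset ℕ} {z : ℕ} {w u₁ w' v' : List ℕ} (hz : z ∉ T)
    (h : Holds V (w ++ z :: u₁) (w' ++ v'))
    (hTu : ∀ t ∈ T, (w ++ z :: u₁).count t = 1) (hTv : ∀ t ∈ T, (w' ++ v').count t = 1)
    (hw : res (insert z T) w = res (insert z T) w')
    (hv' : v' = [] ∨ ∃ t v₁, t ∈ T ∧ v' = t :: v₁)
    (hzu : 2 ≤ (w ++ z :: u₁).count z) (hzv : 2 ≤ (w' ++ v').count z) :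
    ∃ w'', Holds W (w' ++ v') (w'' ++ v') ∧
      res (insert z T) w'' = res (insert z T) w' ++ [z] ∧
      w''.filter (· ≠ z) = w'.filter (· ≠ z) := by
  have hzT : z ∈ insert z T := Finset.mem_insert_self z T
  have hcz : w.count z = w'.count z := by rw [← count_res hzT, hw, count_res hzT]
  have hct : ∀ t ∈ T, w.count t = w'.count t := fun t ht => by
    rw [← count_res (Finset.mem_insert_of_mem ht), hw, count_res (Finset.mem_insert_of_mem ht)]
  have key : ∀ (M : Type u) [Monoid M], V M → ∀ φ : ℕ → M, (∀ c, c ∉ insert z T → φ c = 1) →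
      ev φ w' * φ z * ev φ u₁ = ev φ w' * ev φ v' := by
    intro M _ hM φ hφ
    have := h M hM φ
    rw [ev_append, ev_append, ev_cons, ← ev_res φ w hφ, hw, ev_res φ w' hφ] at this
    rw [mul_assoc, this]
  have keepT : ∀ {M : Type u} [Monoid M] {s t : ℕ} (x h k : M), s ∈ T → t ∈ T →
      ∀ c, c ∉ insert z T → keep z s t x h k c = 1 := by
    intro M _ s t x h k hs ht c hc
    simp only [Finset.mem_insert, not_or] at hc
    have h1 : c ≠ s := fun e => hc.2 (e ▸ hs)
    have h2 : c ≠ t := fun e => hc.2 (e ▸ ht)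
    simp [keep, hc.1, h1, h2]
  -- the simple letter at the head of `v'` also follows the occurrence of `z` in `u`
  have tail : ∀ t v₁, t ∈ T → v' = t :: v₁ → t ∉ w' ∧ t ∉ v₁ ∧ t ≠ z ∧
      ∃ a b, u₁ = a ++ t :: b ∧ t ∉ a ∧ t ∉ b := by
    rintro t v₁ ht rfl
    have h1 := hTv t ht
    have h2 := hTu t ht
    have htz : t ≠ z := fun e => hz (e ▸ ht)
    rw [List.count_append, List.count_cons_self] at h1
    rw [List.count_append, hct t ht, List.count_cons_of_ne (Ne.symm htz)] at h2
    have h3 : u₁.count t = 1 := by omega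
    obtain ⟨a, b, rfl, ha⟩ := exists_first (List.count_pos_iff.1 (by omega : 0 < u₁.count t))
    refine ⟨List.count_eq_zero.1 (by omega), List.count_eq_zero.1 (by omega), htz, a, b, rfl,
      ha, ?_⟩
    rw [List.count_append, List.count_cons_self] at h3
    exact List.count_eq_zero.1 (by omega)
  rw [List.count_append] at hzv
  rw [List.count_append, List.count_cons_self, hcz] at hzu
  by_cases hzw : z ∈ w'
  swap
  · -- `z` has not occurred yet
    have hz0 : w'.count z = 0 := List.count_eq_zero_of_not_mem hzw
    obtain ⟨t, v₁, ht, rfl⟩ : ∃ t v₁, t ∈ T ∧ v' = t :: v₁ := by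
      rcases hv' with rfl | h
      · simp [hz0] at hzv
      · exact h
    obtain ⟨htw, htv, htz, a, b, rfl, hta, htb⟩ := tail t v₁ ht rfl
    -- Keeping only z and t turns the identity into x^(i+1)·k·x^j ≈ k·x^l, where l ≥ 2 because all
    -- occurrences of z in the right-hand word come after t.
    have I₁ : ∀ (M : Type u) [Monoid M], W M → Id₁ M := by
      refine hVW.id₁_of (a := a.count z + 1) (j := b.count z) (l := v₁.count z) (by omega) ?_ ?_ ?_
      · simp only [List.count_append, List.count_cons_of_ne htz] at hzu; omega
      · simp only [List.count_cons_of_ne htz] at hzv; omega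
      · intro M _ hM x k
        have := key M hM (keep z t t x k k) (keepT x k k ht ht)
        rw [ev_append, ev_cons, ev_cons, ev_keep_of_notMem (Or.inl htw) (Or.inl htw),
          ev_keep_of_notMem (Or.inl hta) (Or.inl hta), ev_keep_of_notMem (Or.inl htb) (Or.inl htb),
          ev_keep_of_notMem (Or.inl htv) (Or.inl htv), hz0] at this
        simpa [keep, htz, pow_succ', mul_assoc] using this
    refine ⟨w' ++ [z], fun M _ hM φ => ?_, by simp [res_cons_of_mem hzT], by simp⟩
    have hzv₁ : 2 ≤ v₁.count z := by
      simp only [List.count_cons_of_ne htz] at hzv; omega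
    obtain ⟨m₁, m₂, rfl, hm₁⟩ := exists_first (List.count_pos_iff.1 (by omega : 0 < v₁.count z))
    rw [List.count_append, List.count_cons_self, List.count_eq_zero_of_not_mem hm₁] at hzv₁
    obtain ⟨m₃, m₄, rfl, -⟩ := exists_first (List.count_pos_iff.1 (by omega : 0 < m₂.count z))
    have B := hVW.base M hM
    -- Under xhx ≈ hx² every earlier occurrence can be pushed to the last one, so the words with and
    -- without the new z have a common form.
    have I := I₁ M hM
    simp only [ev_append, ev_cons, ev_nil, mul_one, mul_assoc]
    congr 1
    generalize φ z = x, φ t = k, ev φ m₁ = p, ev φ m₃ = q, ev φ m₄ = r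
    have e1 : x * (k * p) * x = k * p * x * x := I x (k * p)
    have e2 : x * q * x = q * x * x := I x q
    have e3 : x * (k * p * q) * x = k * p * q * x * x := I x _
    have lhs : k * p * x * q * x = k * p * q * x * x := by
      rw [show k * p * x * q * x = k * p * (x * q * x) by simp only [mul_assoc], e2]
      simp only [mul_assoc]
    have rhs : x * k * p * x * q * x = k * p * q * x * x := by
      rw [show x * k * p * x * q * x = x * k * p * (x * q * x) by simp only [mul_assoc], e2,
        show x * k * p * (q * x * x) = (x * (k * p * q) * x) * x by simp only [mul_assoc], e3,
        B.dup ((Has.self x).mul_left _)]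
    have := congrArg (· * r) (lhs.trans rhs.symm)
    simpa only [mul_assoc] using this
  obtain ⟨w₁, w₂, rfl, hzw₂⟩ := exists_last hzw
  have hk : (w₁ ++ z :: w₂).count z = w₁.count z + 1 := by
    rw [List.count_append, List.count_cons_self, List.count_eq_zero_of_not_mem hzw₂]
  rw [hk] at hzu hzv
  -- With a single z in `w'`, keeping z and t gives x^(i+2)·k·x^j ≈ x·k·x^l.
  have I₄ : w₁.count z = 0 → ∀ (M : Type u) [Monoid M], W M → Id₄ M := by
    intro h0
    have hzw₁ : z ∉ w₁ := List.count_eq_zero.1 h0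
    obtain ⟨t, v₁, ht, rfl⟩ : ∃ t v₁, t ∈ T ∧ v' = t :: v₁ := by
      rcases hv' with rfl | h
      · simp [h0] at hzv
      · exact h
    obtain ⟨htw, htv, htz, a, b, rfl, hta, htb⟩ := tail t v₁ ht rfl
    refine hVW.id₄_of (a := a.count z + 2) (j := b.count z) (l := v₁.count z) (by omega) ?_
    · intro M _ hM x k
      have := key M hM (keep z t t x k k) (keepT x k k ht ht)
      rw [ev_append _ a, ev_cons, ev_cons, ev_keep_of_notMem (Or.inl htw) (Or.inl htw),
        ev_keep_of_notMem (Or.inl hta) (Or.inl hta), ev_keep_of_notMem (Or.inl htb) (Or.inl htb),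
        ev_keep_of_notMem (Or.inl htv) (Or.inl htv), hk, h0] at this
      simpa [keep, htz, pow_succ', mul_assoc] using this
  have dup_res : (∀ c ∈ w₂, c ∉ T) →
      res (insert z T) (w₁ ++ z :: z :: w₂) = res (insert z T) (w₁ ++ z :: w₂) ++ [z] := by
    intro h2
    have : res (insert z T) w₂ = [] := res_eq_nil fun c hc => by
      simp only [Finset.mem_insert, not_or]
      exact ⟨fun e => hzw₂ (e ▸ hc), h2 c hc⟩
    simp [res_cons_of_mem hzT, this]
  by_cases hw₂ : ∀ c ∈ w₂, c ∉ T
  · -- `z` already occurs in the current block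
    refine ⟨w₁ ++ z :: z :: w₂, fun M _ hM φ => ?_, dup_res hw₂, by simp⟩
    have B := hVW.base M hM
    rcases Nat.eq_zero_or_pos (w₁.count z) with h0 | h0
    · obtain ⟨m₁, m₂, rfl⟩ := List.append_of_mem
        (List.count_pos_iff.1 (by omega : 0 < v'.count z))
      have := I₄ h0 M hM (φ z) (ev φ w₂ * ev φ m₁)
      have := congrArg (fun g => ev φ w₁ * g * ev φ m₂) this
      simp only [ev_append, ev_cons]
      simp only [mul_assoc] at this ⊢
      exact this.symm
    · have := B.dup (has_ev φ (List.count_pos_iff.1 h0))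
      simp only [ev_append, ev_cons, ← mul_assoc, this]
  -- From here on a simple letter s separates the last z of `w'` from the insertion point. Whether z
  -- still occurs in `v'` decides between x²hx ≈ x²h and x²hxtx ≈ x²htx.
  push Not at hw₂
  obtain ⟨s, hsw, hs⟩ := hw₂
  obtain ⟨c₁, c₂, rfl⟩ := List.append_of_mem hsw
  have hsz : s ≠ z := fun e => hz (e ▸ hs)
  have hs1 := hTv s hs
  simp only [List.count_append, List.count_cons_self, List.count_cons_of_ne (Ne.symm hsz)] at hs1
  have hsu : s ∉ u₁ := by
    have h1 := hTu s hs
    rw [List.count_append, hct s hs, List.count_cons_of_ne (Ne.symm hsz)] at h1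
    simp only [List.count_append, List.count_cons_self, List.count_cons_of_ne (Ne.symm hsz)] at h1
    exact List.count_eq_zero.1 (by omega)
  have hs₁ : s ∉ w₁ := List.count_eq_zero.1 (by omega)
  have hs₂ : s ∉ c₁ := List.count_eq_zero.1 (by omega)
  have hs₃ : s ∉ c₂ := List.count_eq_zero.1 (by omega)
  have hsv : s ∉ v' := List.count_eq_zero.1 (by omega)
  have hzc₁ : c₁.count z = 0 := List.count_eq_zero_of_not_mem fun h => hzw₂ (by simp [h])
  have hzc₂ : c₂.count z = 0 := List.count_eq_zero_of_not_mem fun h => hzw₂ (by simp [h])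
  refine ⟨w₁ ++ z :: (c₁ ++ s :: c₂) ++ [z], fun M _ hM φ => ?_,
    by rw [res_append _ _ [z], res_cons_of_mem hzT, res_nil],
    by rw [List.filter_append, show [z].filter (· ≠ z) = [] by simp, List.append_nil]⟩
  have B := hVW.base M hM
  by_cases hzv' : z ∈ v'
  swap
  · have hv0 : v'.count z = 0 := List.count_eq_zero_of_not_mem hzv'
    have I₂ : ∀ (M : Type u) [Monoid M], W M → Id₂ M := by
      refine hVW.id₂_of (a := w₁.count z + 1) (i := u₁.count z + 1) (by omega) (by omega) ?_
      intro M _ hM x k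
      have := key M hM (keep z s s x k k) (keepT x k k hs hs)
      simp only [ev_append, ev_cons] at this
      rw [ev_keep_of_notMem (Or.inl hs₁) (Or.inl hs₁), ev_keep_of_notMem (Or.inl hs₂) (Or.inl hs₂),
        ev_keep_of_notMem (Or.inl hs₃) (Or.inl hs₃), ev_keep_of_notMem (Or.inl hsv) (Or.inl hsv),
        ev_keep_of_notMem (Or.inl hsu) (Or.inl hsu), hzc₁, hzc₂, hv0] at this
      simp only [keep, hsz, if_true, if_false, pow_zero, one_mul, mul_one] at this
      rw [pow_succ (n := w₁.count z), pow_succ']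
      simpa only [mul_assoc] using this
    have hd := B.dup (has_ev φ (List.count_pos_iff.1 (by omega : 0 < w₁.count z)))
    have := I₂ M hM (φ z) (ev φ (c₁ ++ s :: c₂))
    have := congrArg (fun g => ev φ w₁ * g * ev φ v') this
    simp only [ev_append _ w₁, ev_cons _ z, ev_append _ _ v', ev_append _ _ [z], ev_nil, mul_one]
    simp only [← mul_assoc] at this ⊢
    rw [hd] at this
    exact this.symm
  · obtain ⟨t, v₁, ht, rfl⟩ : ∃ t v₁, t ∈ T ∧ v' = t :: v₁ := by
      rcases hv' with rfl | h
      · simp at hzv'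
      · exact h
    obtain ⟨htw, htv, htz, a, b, rfl, hta, htb⟩ := tail t v₁ ht rfl
    have hst : s ≠ t := fun e => hsv (by simp [e])
    have I₃ : ∀ (M : Type u) [Monoid M], W M → Id₃ M := by
      refine hVW.id₃_of (a := w₁.count z + 1) (i := a.count z + 1) (j := b.count z)
        (l := v₁.count z) (by omega) (by omega) ?_
      intro M _ hM x k k'
      have := key M hM (keep z s t x k k') (keepT x k k' hs ht)
      simp only [List.mem_append, List.mem_cons, not_or] at htw hsv hsu
      simp only [ev_append, ev_cons] at this
      rw [ev_keep_of_notMem (Or.inl hs₁) (Or.inl htw.1),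
        ev_keep_of_notMem (Or.inl hs₂) (Or.inl htw.2.2.1),
        ev_keep_of_notMem (Or.inl hs₃) (Or.inl htw.2.2.2.2),
        ev_keep_of_notMem (Or.inl hsv.2) (Or.inl htv),
        ev_keep_of_notMem (Or.inl hsu.1) (Or.inl hta),
        ev_keep_of_notMem (Or.inl hsu.2.2) (Or.inl htb), hzc₁, hzc₂] at this
      simp only [keep, hsz, htz, hst.symm, if_true, if_false, pow_zero, one_mul, mul_one] at this
      rw [pow_succ (n := w₁.count z), pow_succ' (n := a.count z)]
      simpa only [mul_assoc] using this
    have hzv₁ : z ∈ v₁ := by simpa [Ne.symm htz] using hzv'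
    obtain ⟨m₁, m₂, rfl⟩ := List.append_of_mem hzv₁
    have i₃ := I₃ M hM (φ z) (ev φ (c₁ ++ s :: c₂)) (φ t * ev φ m₁)
    have main : ev φ w₁ * φ z * φ z * ev φ (c₁ ++ s :: c₂) * φ z * φ t * ev φ m₁ * φ z =
        ev φ w₁ * φ z * φ z * ev φ (c₁ ++ s :: c₂) * φ t * ev φ m₁ * φ z := by
      have := congrArg (ev φ w₁ * ·) i₃
      simpa only [← mul_assoc] using this
    -- The identity x²hxtx ≈ x²htx needs a square in front. If z occurs in `w₁`, the square comes
    -- from `dup`; otherwise from x²hx ≈ xhx.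
    have rem : ev φ w₁ * φ z * ev φ (c₁ ++ s :: c₂) * φ z * φ t * ev φ m₁ * φ z =
        ev φ w₁ * φ z * ev φ (c₁ ++ s :: c₂) * φ t * ev φ m₁ * φ z := by
      rcases Nat.eq_zero_or_pos (w₁.count z) with h0 | h0
      · have i1 := congrArg (ev φ w₁ * ·) (I₄ h0 M hM (φ z) (ev φ (c₁ ++ s :: c₂)))
        have i2 := congrArg (ev φ w₁ * ·)
          (I₄ h0 M hM (φ z) (ev φ (c₁ ++ s :: c₂) * φ t * ev φ m₁))
        simp only [← mul_assoc] at i1 i2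
        rw [← i1, ← i2, main]
      · rwa [B.dup (has_ev φ (List.count_pos_iff.1 h0))] at main
    simp only [ev_append _ w₁, ev_cons _ z, ev_cons _ t, ev_append _ m₁, ev_append _ _ [z],
      ev_append _ _ (t :: _), ev_nil, mul_one]
    have := congrArg (· * ev φ m₂) rem
    simp only [← mul_assoc] at this ⊢
    exact this.symm

end Approx

/-- `u ≈ v` holds in `V`, and `T` is the set of simple letters of both words. -/
structure Linked (V : MonoidClass.{u}) (T : Finset ℕ) (u v : List ℕ) : Prop where
  holds : Holds V u v
  simple_left : ∀ t ∈ T, u.count t = 1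
  simple_right : ∀ t ∈ T, v.count t = 1
  repeated_left : ∀ z ∈ u, z ∉ T → 2 ≤ u.count z
  repeated_right : ∀ z ∈ v, z ∉ T → 2 ≤ v.count z

theorem count_of_filter_ne {z c : ℕ} (h : c ≠ z) {l m : List ℕ}
    (e : l.filter (· ≠ z) = m.filter (· ≠ z)) : l.count c = m.count c := by
  have := congrArg (List.count c) e
  rwa [List.count_filter (by simpa using h), List.count_filter (by simpa using h)] at this

theorem res_of_filter_ne {z : ℕ} {A : Finset ℕ} (h : z ∉ A) {l m : List ℕ}
    (e : l.filter (· ≠ z) = m.filter (· ≠ z)) : res A l = res A m := by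
  have key : ∀ l : List ℕ, res A (l.filter (· ≠ z)) = res A l := by
    intro l
    simp only [res, List.filter_filter]
    congr 1
    funext c
    by_cases hc : c ∈ A
    · have : c ≠ z := fun h' => h (h' ▸ hc)
      simp [hc, this]
    · simp [hc]
  rw [← key l, e, key]

theorem res_insert_eq_nil_or {A : Finset ℕ} (l : List ℕ) :
    ∃ a b, l = a ++ b ∧ res A a = [] ∧ (b = [] ∨ ∃ c b', b = c :: b' ∧ c ∈ A) := by
  induction l with
  | nil => exact ⟨[], [], by simp⟩
  | cons c l ih =>
    by_cases hc : c ∈ A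
    · exact ⟨[], c :: l, by simp [hc]⟩
    · obtain ⟨a, b, rfl, ha, hb⟩ := ih
      exact ⟨c :: a, b, rfl, by rw [res_cons_of_notMem hc, ha], hb⟩

namespace Approx
variable {V W : MonoidClass.{u}} (hVW : Approx V W)
include hVW

/-- Both words are scanned simultaneously: `w` and `w'` are the parts already aligned, `u'` and `v'`
the unread ones. An insertion lengthens a part already read while the other word consumes a z, so
the total unread length drops. -/
theorem align_aux {T : Finset ℕ} {z : ℕ} (hz : z ∉ T) (n : ℕ) (w u' w' v' : List ℕ)
    (hn : u'.length + v'.length ≤ n) (h : Holds V (w ++ u') (w' ++ v'))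
    (hTu : ∀ t ∈ T, (w ++ u').count t = 1) (hTv : ∀ t ∈ T, (w' ++ v').count t = 1)
    (hw : res (insert z T) w = res (insert z T) w')
    (hzu : 2 ≤ (w ++ u').count z) (hzv : 2 ≤ (w' ++ v').count z) :
    ∃ u₀ v₀, Holds W (w ++ u') u₀ ∧ Holds W (w' ++ v') v₀ ∧
      res (insert z T) u₀ = res (insert z T) v₀ ∧
      u₀.filter (· ≠ z) = (w ++ u').filter (· ≠ z) ∧
      v₀.filter (· ≠ z) = (w' ++ v').filter (· ≠ z) ∧
      2 ≤ u₀.count z ∧ 2 ≤ v₀.count z := by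
  induction n using Nat.strong_induction_on generalizing w u' w' v' with
  | _ n ih =>
  obtain ⟨a, b, rfl, ha, hb⟩ := res_insert_eq_nil_or (A := insert z T) u'
  obtain ⟨a', b', rfl, ha', hb'⟩ := res_insert_eq_nil_or (A := insert z T) v'
  rw [← List.append_assoc] at h hTu hzu ⊢
  rw [← List.append_assoc w'] at h hTv hzv ⊢
  have hwa : res (insert z T) (w ++ a) = res (insert z T) (w' ++ a') := by
    rw [res_append, res_append, ha, ha', hw]
  have hlen : b.length + b'.length ≤ n := by simp at hn; omega
  generalize w ++ a = w at *
  generalize w' ++ a' = w' at *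
  have hT : res T b = res T b' := by
    have := hVW.simple_order h hTu hTv
    rw [res_append, res_append, res_mono (Finset.subset_insert z T) hwa] at this
    exact List.append_cancel_left this
  -- The case in which the left word continues with z and the right one does not; the opposite case
  -- is this one with the words exchanged.
  have step : ∀ (w w' b₁ b' : List ℕ), b₁.length + b'.length < n →
      Holds V (w ++ z :: b₁) (w' ++ b') → (∀ t ∈ T, (w ++ z :: b₁).count t = 1) →
      (∀ t ∈ T, (w' ++ b').count t = 1) → res (insert z T) w = res (insert z T) w' →
      2 ≤ (w ++ z :: b₁).count z → 2 ≤ (w' ++ b').count z →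
      (b' = [] ∨ ∃ t v₁, t ∈ T ∧ b' = t :: v₁) →
      ∃ u₀ v₀, Holds W (w ++ z :: b₁) u₀ ∧ Holds W (w' ++ b') v₀ ∧
        res (insert z T) u₀ = res (insert z T) v₀ ∧
        u₀.filter (· ≠ z) = (w ++ z :: b₁).filter (· ≠ z) ∧
        v₀.filter (· ≠ z) = (w' ++ b').filter (· ≠ z) ∧
        2 ≤ u₀.count z ∧ 2 ≤ v₀.count z := by
    intro w w' b₁ b' hlt h hTu hTv hw hzu hzv hb'
    obtain ⟨w'', h₁, h₂, h₃⟩ := hVW.insertion hz h hTu hTv hw hb' hzu hzv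
    have hc : w''.count z = w'.count z + 1 := by
      rw [← count_res (Finset.mem_insert_self z T), h₂, List.count_append,
        count_res (Finset.mem_insert_self z T)]
      simp
    obtain ⟨u₀, v₀, e₁, e₂, e₃, e₄, e₅, e₆, e₇⟩ := ih _ hlt (w ++ [z]) b₁ w'' b' le_rfl
      (by simpa using h.trans (hVW.holds_le h₁)) (by simpa using hTu)
      (by
        intro t ht
        have htz : t ≠ z := fun e => hz (e ▸ ht)
        rw [List.count_append, count_of_filter_ne htz h₃, ← List.count_append, hTv t ht])
      (by rw [res_append, hw, h₂, res_cons_of_mem (Finset.mem_insert_self z T), res_nil])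
      (by simpa using hzu) (by rw [List.count_append] at hzv ⊢; omega)
    refine ⟨u₀, v₀, by simpa using e₁, h₁.trans e₂, e₃, by simpa using e₄, ?_, e₆, e₇⟩
    rw [e₅, List.filter_append, h₃, List.filter_append]
  have swap : ∀ {t : ℕ}, t ∈ insert z T → t ≠ z → t ∈ T := fun h h' =>
    (Finset.mem_insert.1 h).resolve_left h'
  rcases hb with rfl | ⟨c, b, rfl, hc⟩
  · rcases hb' with rfl | ⟨c', b', rfl, hc'⟩
    · simp only [List.append_nil] at *
      exact ⟨w, w', fun _ _ _ _ => rfl, fun _ _ _ _ => rfl, hwa, rfl, rfl, hzu, hzv⟩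
    · by_cases hcz : c' = z
      · subst hcz
        obtain ⟨v₀, u₀, e₁, e₂, e₃, e₄, e₅, e₆, e₇⟩ := step w' w b' [] (by simp at hlen ⊢; omega)
          h.symm hTv hTu hwa.symm hzv hzu (Or.inl rfl)
        exact ⟨u₀, v₀, e₂, e₁, e₃.symm, e₅, e₄, e₇, e₆⟩
      · rw [res_cons_of_mem (swap hc' hcz)] at hT
        simp at hT
  · by_cases hcz : c = z
    · subst hcz
      rcases hb' with rfl | ⟨c', b', rfl, hc'⟩
      · exact step w w' b [] (by simp at hlen ⊢; omega) h hTu hTv hwa hzu hzv (Or.inl rfl)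
      · by_cases hcz' : c' = c
        · subst hcz'
          obtain ⟨u₀, v₀, e⟩ := ih (b.length + b'.length) (by simp at hlen; omega) (w ++ [c']) b
            (w' ++ [c']) b' le_rfl (by simpa using h) (by simpa using hTu) (by simpa using hTv)
            (by rw [res_append, hwa, res_append]) (by simpa using hzu) (by simpa using hzv)
          exact ⟨u₀, v₀, by simpa using e⟩
        · exact step w w' b (c' :: b') (by simp at hlen ⊢; omega) h hTu hTv hwa hzu hzv
            (Or.inr ⟨c', b', swap hc' hcz', rfl⟩)
    · have hcT := swap hc hcz
      rcases hb' with rfl | ⟨c', b', rfl, hc'⟩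
      · rw [res_cons_of_mem hcT] at hT
        simp at hT
      · by_cases hcz' : c' = z
        · subst hcz'
          obtain ⟨v₀, u₀, e₁, e₂, e₃, e₄, e₅, e₆, e₇⟩ := step w' w b' (c :: b)
            (by simp at hlen ⊢; omega) h.symm hTv hTu hwa.symm hzv hzu (Or.inr ⟨c, b, hcT, rfl⟩)
          exact ⟨u₀, v₀, e₂, e₁, e₃.symm, e₅, e₄, e₇, e₆⟩
        · rw [res_cons_of_mem hcT, res_cons_of_mem (swap hc' hcz')] at hT
          obtain rfl := (List.cons.inj hT).1
          obtain ⟨u₀, v₀, e⟩ := ih (b.length + b'.length) (by simp at hlen; omega) (w ++ [c]) b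
            (w' ++ [c]) b' le_rfl (by simpa using h) (by simpa using hTu) (by simpa using hTv)
            (by rw [res_append, hwa, res_append]) (by simpa using hzu) (by simpa using hzv)
          exact ⟨u₀, v₀, by simpa using e⟩

theorem mem_iff {u v : List ℕ} (h : Holds V u v) (z : ℕ) : z ∈ u ↔ z ∈ v := by
  rw [← List.count_pos_iff, ← List.count_pos_iff]
  rcases hVW.count_iff h z with h | h <;> omega

theorem align_letter {T : Finset ℕ} {u v : List ℕ} (h : Linked V T u v) {z : ℕ} (hz : z ∉ T) :
    ∃ u₀ v₀, Holds W u u₀ ∧ Holds W v v₀ ∧ Linked V T u₀ v₀ ∧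
      res (insert z T) u₀ = res (insert z T) v₀ ∧ u₀ ⊆ u ∧
      u₀.filter (· ≠ z) = u.filter (· ≠ z) ∧ v₀.filter (· ≠ z) = v.filter (· ≠ z) := by
  by_cases hzu : z ∈ u
  · have hzv := (hVW.mem_iff h.holds z).1 hzu
    obtain ⟨u₀, v₀, e₁, e₂, e₃, e₄, e₅, e₆, e₇⟩ := hVW.align_aux hz _ [] u [] v le_rfl
      (by simpa using h.holds) (by simpa using h.simple_left) (by simpa using h.simple_right) rfl
      (by simpa using h.repeated_left z hzu hz) (by simpa using h.repeated_right z hzv hz)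
    simp only [List.nil_append] at e₁ e₂ e₄ e₅
    refine ⟨u₀, v₀, e₁, e₂, ⟨?_, ?_, ?_, ?_, ?_⟩, e₃, ?_, e₄, e₅⟩
    · exact (hVW.holds_le e₁).symm.trans (h.holds.trans (hVW.holds_le e₂))
    · intro t ht
      rw [count_of_filter_ne (fun e : t = z => hz (e ▸ ht)) e₄, h.simple_left t ht]
    · intro t ht
      rw [count_of_filter_ne (fun e : t = z => hz (e ▸ ht)) e₅, h.simple_right t ht]
    · intro c hc hcT
      by_cases hcz : c = z
      · rwa [hcz]
      · rw [← List.count_pos_iff] at hc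
        rw [count_of_filter_ne hcz e₄] at hc ⊢
        exact h.repeated_left c (List.count_pos_iff.1 hc) hcT
    · intro c hc hcT
      by_cases hcz : c = z
      · rwa [hcz]
      · rw [← List.count_pos_iff] at hc
        rw [count_of_filter_ne hcz e₅] at hc ⊢
        exact h.repeated_right c (List.count_pos_iff.1 hc) hcT
    · intro c hc
      by_cases hcz : c = z
      · rwa [hcz]
      · rw [← List.count_pos_iff] at hc ⊢
        rwa [← count_of_filter_ne hcz e₄]
  · have hzv : z ∉ v := fun h' => hzu ((hVW.mem_iff h.holds z).2 h')
    refine ⟨u, v, fun _ _ _ _ => rfl, fun _ _ _ _ => rfl, h, ?_, List.Subset.refl _, rfl, rfl⟩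
    have key : ∀ l : List ℕ, z ∉ l → res (insert z T) l = res T l := by
      intro l hl
      refine List.filter_congr fun c hc => ?_
      have : c ≠ z := fun e => hl (e ▸ hc)
      simp [this]
    rw [key u hzu, key v hzv, hVW.simple_order h.holds h.simple_left h.simple_right]

/-- Aligning z changes only occurrences of z, so letters aligned earlier stay aligned. -/
theorem align_list {T : Finset ℕ} {u v : List ℕ} (h : Linked V T u v) (S : List ℕ)
    (hS : ∀ z ∈ S, z ∉ T) :
    ∃ u₀ v₀, Holds W u u₀ ∧ Holds W v v₀ ∧ Linked V T u₀ v₀ ∧ u₀ ⊆ u ∧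
      ∀ z ∈ S, res (insert z T) u₀ = res (insert z T) v₀ := by
  induction S with
  | nil => exact ⟨u, v, fun _ _ _ _ => rfl, fun _ _ _ _ => rfl, h, List.Subset.refl _, by simp⟩
  | cons z S ih =>
    obtain ⟨u₁, v₁, e₁, e₂, e₃, e₄, e₅⟩ := ih fun c hc => hS c (by simp [hc])
    obtain ⟨u₀, v₀, f₁, f₂, f₃, f₄, f₅, f₆, f₇⟩ := hVW.align_letter e₃ (hS z (by simp))
    refine ⟨u₀, v₀, e₁.trans f₁, e₂.trans f₂, f₃, List.Subset.trans f₅ e₄, fun c hc => ?_⟩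
    by_cases hcz : c = z
    · rw [hcz, f₄]
    · have hz : z ∉ insert c T := by
        simpa [Ne.symm hcz] using hS z (by simp)
      rw [res_of_filter_ne hz f₆, res_of_filter_ne hz f₇]
      exact e₅ c (by simpa [hcz] using hc)

/-- Every identity of `V` is equivalent within `W` to one both sides of which have, for each
letter, the same restriction to this letter and the simple letters. -/
theorem align {T : Finset ℕ} {u v : List ℕ} (h : Linked V T u v) :
    ∃ u₀ v₀, Holds W u u₀ ∧ Holds W v v₀ ∧ Linked V T u₀ v₀ ∧
      ∀ z, res (insert z T) u₀ = res (insert z T) v₀ := by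
  obtain ⟨u₀, v₀, e₁, e₂, e₃, e₄, e₅⟩ := hVW.align_list h (u.filter (· ∉ T)) (by simp)
  refine ⟨u₀, v₀, e₁, e₂, e₃, fun z => ?_⟩
  have hT := hVW.simple_order e₃.holds e₃.simple_left e₃.simple_right
  by_cases hz : z ∈ T
  · rwa [Finset.insert_eq_of_mem hz]
  by_cases hzu : z ∈ u₀
  · exact e₅ z (by simpa [hz] using e₄ hzu)
  · have hzv : z ∉ v₀ := fun h' => hzu ((hVW.mem_iff e₃.holds z).2 h')
    have key : ∀ l : List ℕ, z ∉ l → res (insert z T) l = res T l := by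
      intro l hl
      refine List.filter_congr fun c hc => ?_
      have : c ≠ z := fun e => hl (e ▸ hc)
      simp [this]
    rw [key _ hzu, key _ hzv, hT]

end Approx

/-! ### Compressing tails, shortening prefixes, and renaming to two letters -/

/-- The `i`-th term of the alternating sequence `a, b, a, b, …`. -/
def alt (a b i : ℕ) : ℕ := if Odd i then a else b

theorem alt_cases (a b i : ℕ) :
    (alt a b i = a ∧ alt a b (i + 1) = b ∧ alt a b (i + 1 + 1) = a ∧
      alt 0 1 i = 0 ∧ alt 0 1 (i + 1) = 1) ∨
    (alt a b i = b ∧ alt a b (i + 1) = a ∧ alt a b (i + 1 + 1) = b ∧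
      alt 0 1 i = 1 ∧ alt 0 1 (i + 1) = 0) := by
  rcases Nat.even_or_odd i with h | h
  · right
    have h1 : ¬ Odd i := Nat.not_odd_iff_even.2 h
    simp [alt, h1, Nat.odd_add_one]
  · left
    simp [alt, h, Nat.odd_add_one]

theorem altList_succ (s m : ℕ) :
    altList s (m + 1) = (4 + s) :: alt 0 1 s :: altList (s + 1) m := by
  simp [altList, List.range'_succ, alt]

theorem mem_altList {s m c : ℕ} (h : c ∈ altList s m) : c = 0 ∨ c = 1 ∨ 4 + s ≤ c := by
  simp only [altList, List.mem_flatMap, List.mem_range'_1] at h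
  obtain ⟨i, hi, hc⟩ := h
  simp only [List.mem_cons, List.not_mem_nil, or_false] at hc
  rcases hc with rfl | rfl
  · omega
  · split_ifs <;> simp

theorem alt_mem_altList {s m i : ℕ} (h : i ∈ List.range' s m) : alt 0 1 i ∈ altList s m := by
  simp only [altList, List.mem_flatMap]
  exact ⟨i, h, by simp [alt]⟩

theorem ev_congr {M : Type u} [Monoid M] {φ ψ : ℕ → M} {l : List ℕ} (h : ∀ c ∈ l, φ c = ψ c) :
    ev φ l = ev ψ l := by
  rw [ev, ev, List.map_congr_left h]

theorem flatMap_congr {f g : ℕ → List ℕ} {l : List ℕ} (h : ∀ c ∈ l, f c = g c) :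
    l.flatMap f = l.flatMap g := by
  induction l with
  | nil => rfl
  | cons c l ih => simp [h c (by simp), ih fun d hd => h d (by simp [hd])]

theorem flatMap_res {f : ℕ → List ℕ} {A : Finset ℕ} {l : List ℕ} (h : ∀ c ∈ l, c ∉ A → f c = []) :
    (res A l).flatMap f = l.flatMap f := by
  induction l with
  | nil => rfl
  | cons c l ih =>
    have ih := ih fun d hd => h d (by simp [hd])
    by_cases hc : c ∈ A
    · rw [res_cons_of_mem hc, List.flatMap_cons, List.flatMap_cons, ih]
    · rw [res_cons_of_notMem hc, List.flatMap_cons, ih, h c (by simp) hc, List.nil_append]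

/-- The index `i` records the letter of the run being read, one occurrence of which is already to
the left. A simple letter immediately before a run of the other letter becomes the next tᵢ, and
other simple letters are erased, so each run collapses by `dup`. Since neither ab nor ba is a
factor, and by `hi` at the start, such a separating simple letter always exists. -/
theorem exists_compression_aux {a b : ℕ} (hab : a ≠ b) (n : ℕ) (D : List ℕ) (hn : D.length ≤ n)
    (i : ℕ) (hD : ∀ t ∈ D, t ≠ a → t ≠ b → D.count t = 1)
    (h₁ : ¬ [a, b] <:+: D) (h₂ : ¬ [b, a] <:+: D) (hi : D.head? ≠ some (alt a b (i + 1))) :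
    ∃ (f : ℕ → List ℕ) (m : ℕ), f a = [0] ∧ f b = [1] ∧
      (∀ z, z ∉ D → z ≠ a → z ≠ b → f z = []) ∧
      ((List.range' (i + 1) m).map (alt a b)).Sublist D ∧
      (∀ z ∈ D, z = a ∨ z = b →
        z = alt a b i ∨ z ∈ (List.range' (i + 1) m).map (alt a b)) ∧
      ∀ (M : Type u) [Monoid M], Base M → ∀ (φ : ℕ → M) (g : M), Has (φ 0) g → Has (φ 1) g →
        g * φ (alt 0 1 i) * ev φ (D.flatMap f) = g * φ (alt 0 1 i) * ev φ (altList (i + 1) m) := by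
  induction n generalizing D i with
  | zero =>
    obtain rfl : D = [] := List.length_eq_zero_iff.1 (by omega)
    refine ⟨fun c => if c = a then [0] else if c = b then [1] else [], 0, by simp,
      by simp [hab.symm], by simp +contextual, by simp, by simp, ?_⟩
    intro M _ _ φ g _ _
    simp [altList]
  | succ n ih =>
    rcases D with _ | ⟨c, D⟩
    · exact ih [] (by simp) i (by simp) h₁ h₂ hi
    have inf₁ : ¬ [a, b] <:+: D := fun h => h₁ (h.trans (List.suffix_cons c D).isInfix)
    have inf₂ : ¬ [b, a] <:+: D := fun h => h₂ (h.trans (List.suffix_cons c D).isInfix)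
    have hcnt : ∀ t ∈ D, t ≠ a → t ≠ b → D.count t = 1 := by
      intro t ht ha hb
      have h := hD t (by simp [ht]) ha hb
      have h' := List.count_pos_iff.2 ht
      rw [List.count_cons] at h
      omega
    have hlen : D.length ≤ n := by simpa using hn
    by_cases hci : c = alt a b i
    · -- one more letter of the current run
      obtain ⟨f, m, ha, hb, hf, hs, hmm, hev⟩ := ih D hlen i hcnt inf₁ inf₂ (by
        intro h
        obtain ⟨D', rfl⟩ : ∃ D', D = alt a b (i + 1) :: D' := by
          cases D with
          | nil => simp at h
          | cons d D => exact ⟨D, by simpa using h⟩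
        rcases alt_cases a b i with ⟨e₁, e₂, -⟩ | ⟨e₁, e₂, -⟩
        · exact h₁ ⟨[], D', by simp [hci, e₁, e₂]⟩
        · exact h₂ ⟨[], D', by simp [hci, e₁, e₂]⟩)
      refine ⟨f, m, ha, hb, fun z hz => hf z fun h => hz (by simp [h]), hs.cons c, ?_, ?_⟩
      · intro z hz hzz
        rcases List.mem_cons.1 hz with rfl | hz
        · exact Or.inl hci
        · exact hmm z hz hzz
      · intro M _ B φ g h0 h1
        have hfc : f c = [alt 0 1 i] := by
          rcases alt_cases a b i with ⟨e₁, -, -, e₂, -⟩ | ⟨e₁, -, -, e₂, -⟩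
          · rw [hci, e₁, e₂, ha]
          · rw [hci, e₁, e₂, hb]
        have hg : Has (φ (alt 0 1 i)) g := by
          rcases alt_cases a b i with ⟨-, -, -, e₂, -⟩ | ⟨-, -, -, e₂, -⟩ <;> rw [e₂] <;>
            assumption
        rw [List.flatMap_cons, hfc, List.singleton_append, ev_cons, ← mul_assoc, B.dup hg,
          hev M B φ g h0 h1]
    have hci' : c ≠ alt a b (i + 1) := by simpa using hi
    have hcab : c ≠ a ∧ c ≠ b := by
      rcases alt_cases a b i with ⟨e₁, e₂, -⟩ | ⟨e₁, e₂, -⟩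
      · exact ⟨fun e => hci (e.trans e₁.symm), fun e => hci' (e.trans e₂.symm)⟩
      · exact ⟨fun e => hci' (e.trans e₂.symm), fun e => hci (e.trans e₁.symm)⟩
    have hcD : c ∉ D := by
      have := hD c (by simp) hcab.1 hcab.2
      rw [List.count_cons_self] at this
      exact List.count_eq_zero.1 (by omega)
    by_cases hhead : D.head? = some (alt a b (i + 1))
    · -- a new run starts after the simple letter `c`
      obtain ⟨D', rfl⟩ : ∃ D', D = alt a b (i + 1) :: D' := by
        cases D with
        | nil => simp at hhead
        | cons d D => exact ⟨D, by simpa using hhead⟩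
      obtain ⟨f, m, ha, hb, hf, hs, hmm, hev⟩ := ih D' (by simp at hlen; omega) (i + 1)
        (by
          intro t ht h1 h2
          have h := hcnt t (by simp [ht]) h1 h2
          have h' := List.count_pos_iff.2 ht
          rw [List.count_cons] at h
          omega)
        (fun h => inf₁ (h.trans (List.suffix_cons _ D').isInfix))
        (fun h => inf₂ (h.trans (List.suffix_cons _ D').isInfix))
        (by
          intro h
          obtain ⟨D'', rfl⟩ : ∃ D'', D' = alt a b (i + 1 + 1) :: D'' := by
            cases D' with
            | nil => simp at h
            | cons d D => exact ⟨D, by simpa using h⟩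
          rcases alt_cases a b i with ⟨e₁, e₂, e₃, -⟩ | ⟨e₁, e₂, e₃, -⟩
          · exact inf₂ ⟨[], D'', by simp [e₂, e₃]⟩
          · exact inf₁ ⟨[], D'', by simp [e₂, e₃]⟩)
      have hcD' : c ∉ D' := fun h => hcD (by simp [h])
      refine ⟨Function.update f c [4 + (i + 1)], m + 1, ?_, ?_, ?_, ?_, ?_, ?_⟩
      · rw [Function.update_of_ne hcab.1.symm, ha]
      · rw [Function.update_of_ne hcab.2.symm, hb]
      · intro z hz hza hzb
        simp only [List.mem_cons, not_or] at hz
        rw [Function.update_of_ne hz.1, hf z hz.2.2 hza hzb]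
      · rw [List.range'_succ, List.map_cons]
        exact (hs.cons_cons _).cons _
      · intro z hz hzz
        rw [List.range'_succ, List.map_cons, List.mem_cons]
        simp only [List.mem_cons] at hz
        rcases hz with rfl | rfl | hz
        · exact absurd hzz (by simp [hcab])
        · exact Or.inr (Or.inl rfl)
        · exact Or.inr (hmm z hz hzz)
      · intro M _ B φ g h0 h1
        have hfc : f (alt a b (i + 1)) = [alt 0 1 (i + 1)] := by
          rcases alt_cases a b i with ⟨-, e₁, -, -, e₂⟩ | ⟨-, e₁, -, -, e₂⟩
          · rw [e₁, e₂, hb]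
          · rw [e₁, e₂, ha]
        have hne : alt a b (i + 1) ≠ c := Ne.symm hci'
        rw [List.flatMap_cons, List.flatMap_cons, Function.update_self,
          Function.update_of_ne hne, hfc, altList_succ,
          flatMap_congr (g := f) (l := D') fun d hd => Function.update_of_ne
            (fun e : d = c => hcD' (e ▸ hd)) _ _]
        have := hev M B φ (g * φ (alt 0 1 i) * φ (4 + (i + 1)))
          ((h0.mul_right _).mul_right _) ((h1.mul_right _).mul_right _)
        simpa [mul_assoc] using this
    · obtain ⟨f, m, ha, hb, hf, hs, hmm, hev⟩ := ih D hlen i hcnt inf₁ inf₂ hhead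
      refine ⟨f, m, ha, hb, fun z hz => hf z fun h => hz (by simp [h]), hs.cons c, ?_, ?_⟩
      · intro z hz hzz
        rcases List.mem_cons.1 hz with rfl | hz
        · exact absurd hzz (by simp [hcab])
        · exact hmm z hz hzz
      · intro M _ B φ g h0 h1
        rw [List.flatMap_cons, hf c hcD hcab.1 hcab.2, List.nil_append, hev M B φ g h0 h1]

/-- A tail without a block that contains both `a` and `b` can be compressed to an alternating
tail by a substitution. -/
theorem exists_compression {a b : ℕ} (hab : a ≠ b) (D : List ℕ)
    (hD : ∀ t ∈ D, t ≠ a → t ≠ b → D.count t = 1)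
    (h₁ : ¬ [a, b] <:+: D) (h₂ : ¬ [b, a] <:+: D)
    (hhead : D.head? ≠ some a ∧ D.head? ≠ some b) :
    ∃ (f : ℕ → List ℕ) (s m : ℕ), (s = 1 ∨ s = 2) ∧ f a = [0] ∧ f b = [1] ∧
      (∀ z, z ∉ D → z ≠ a → z ≠ b → f z = []) ∧
      ((List.range' s m).map (alt a b)).Sublist D ∧
      (∀ z ∈ D, z = a ∨ z = b → z ∈ (List.range' s m).map (alt a b)) ∧
      ∀ (M : Type u) [Monoid M], Base M → ∀ (φ : ℕ → M) (g : M), Has (φ 0) g → Has (φ 1) g →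
        g * ev φ (D.flatMap f) = g * ev φ (altList s m) := by
  induction D with
  | nil =>
    refine ⟨fun c => if c = a then [0] else if c = b then [1] else [], 1, 0, by simp, by simp,
      by simp [hab.symm], by simp +contextual, by simp, by simp, ?_⟩
    intro M _ _ φ g _ _
    simp [altList]
  | cons c D ih =>
    have hca : c ≠ a := by simpa using hhead.1
    have hcb : c ≠ b := by simpa using hhead.2
    have inf₁ : ¬ [a, b] <:+: D := fun h => h₁ (h.trans (List.suffix_cons c D).isInfix)
    have inf₂ : ¬ [b, a] <:+: D := fun h => h₂ (h.trans (List.suffix_cons c D).isInfix)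
    have hcnt : ∀ t ∈ D, t ≠ a → t ≠ b → D.count t = 1 := by
      intro t ht ha hb
      have h := hD t (by simp [ht]) ha hb
      have h' := List.count_pos_iff.2 ht
      rw [List.count_cons] at h
      omega
    have hcD : c ∉ D := by
      have := hD c (by simp) hca hcb
      rw [List.count_cons_self] at this
      exact List.count_eq_zero.1 (by omega)
    by_cases hnew : D.head? ≠ some a ∧ D.head? ≠ some b
    · obtain ⟨f, s, m, hs, ha, hb, hf, hsub, hmm, hev⟩ := ih hcnt inf₁ inf₂ hnew
      refine ⟨f, s, m, hs, ha, hb, fun z hz => hf z fun h => hz (by simp [h]), hsub.cons c, ?_, ?_⟩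
      · intro z hz hzz
        rcases List.mem_cons.1 hz with rfl | hz
        · exact absurd hzz (by simp [hca, hcb])
        · exact hmm z hz hzz
      · intro M _ B φ g h0 h1
        rw [List.flatMap_cons, hf c hcD hca hcb, List.nil_append, hev M B φ g h0 h1]
    · obtain ⟨s, D', hs, rfl⟩ : ∃ s D', (s = 1 ∨ s = 2) ∧ D = alt a b s :: D' := by
        cases D with
        | nil => simp at hnew
        | cons d D =>
          simp only [List.head?_cons, ne_eq, Option.some.injEq, not_and_or, not_not] at hnew
          rcases hnew with rfl | rfl
          · exact ⟨1, D, Or.inl rfl, by simp [alt]⟩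
          · exact ⟨2, D, Or.inr rfl, by simp [alt]⟩
      obtain ⟨f, m, ha, hb, hf, hsub, hmm, hev⟩ := exists_compression_aux.{u} hab _ D' le_rfl s
        (by
          intro t ht h1 h2
          have h := hcnt t (by simp [ht]) h1 h2
          have h' := List.count_pos_iff.2 ht
          rw [List.count_cons] at h
          omega)
        (fun h => inf₁ (h.trans (List.suffix_cons _ D').isInfix))
        (fun h => inf₂ (h.trans (List.suffix_cons _ D').isInfix))
        (by
          intro h
          obtain ⟨D'', rfl⟩ : ∃ D'', D' = alt a b (s + 1) :: D'' := by
            cases D' with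
            | nil => simp at h
            | cons d D => exact ⟨D, by simpa using h⟩
          rcases alt_cases a b s with ⟨e₁, e₂, -⟩ | ⟨e₁, e₂, -⟩
          · exact inf₁ ⟨[], D'', by simp [e₁, e₂]⟩
          · exact inf₂ ⟨[], D'', by simp [e₁, e₂]⟩)
      have hcD' : c ∉ D' := fun h => hcD (by simp [h])
      -- The simple letter before the first run becomes t_s, with s = 1 or 2 according as that run
      -- consists of a or of b.
      refine ⟨Function.update f c [4 + s], s, m + 1, hs, ?_, ?_, ?_, ?_, ?_, ?_⟩
      · rw [Function.update_of_ne hca.symm, ha]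
      · rw [Function.update_of_ne hcb.symm, hb]
      · intro z hz hza hzb
        simp only [List.mem_cons, not_or] at hz
        rw [Function.update_of_ne hz.1, hf z hz.2.2 hza hzb]
      · rw [List.range'_succ, List.map_cons]
        exact (hsub.cons_cons _).cons _
      · intro z hz hzz
        rw [List.range'_succ, List.map_cons, List.mem_cons]
        simp only [List.mem_cons] at hz
        rcases hz with rfl | rfl | hz
        · exact absurd hzz (by simp [hca, hcb])
        · exact Or.inl rfl
        · exact hmm z hz hzz
      · intro M _ B φ g h0 h1
        have hfc : f (alt a b s) = [alt 0 1 s] := by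
          rcases alt_cases a b s with ⟨e₁, -, -, e₂, -⟩ | ⟨e₁, -, -, e₂, -⟩
          · rw [e₁, e₂, ha]
          · rw [e₁, e₂, hb]
        have hne : alt a b s ≠ c := fun e => hcD (by simp [e])
        rw [List.flatMap_cons, List.flatMap_cons, Function.update_self,
          Function.update_of_ne hne, hfc, altList_succ,
          flatMap_congr (g := f) (l := D') fun d hd => Function.update_of_ne
            (fun e : d = c => hcD' (e ▸ hd)) _ _]
        have := hev M B φ (g * φ (4 + s)) (h0.mul_right _) (h1.mul_right _)
        simpa [mul_assoc] using this

/-- An alternating tail matches every word that contains its letters in the same order. -/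
theorem exists_match {M : Type u} [Monoid M] (φ : ℕ → M) (a b m s : ℕ) (l : List ℕ)
    (h : ((List.range' s m).map (alt a b)).Sublist l) :
    ∃ (ψ : ℕ → M) (k : M), ψ 0 = φ a ∧ ψ 1 = φ b ∧ ev φ l = ev ψ (altList s m) * k := by
  induction m generalizing s l with
  | zero => exact ⟨fun n => if n = 0 then φ a else φ b, ev φ l, by simp, by simp, by simp [altList]⟩
  | succ m ih =>
    rw [List.range'_succ, List.map_cons, List.cons_sublist_iff] at h
    obtain ⟨r₁, r₂, rfl, h₁, h₂⟩ := h
    obtain ⟨c, d, rfl⟩ := List.append_of_mem h₁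
    obtain ⟨ψ, k, h0, h1, hk⟩ := ih (s + 1) (d ++ r₂) (h₂.trans (List.sublist_append_right d r₂))
    -- The letter t_s takes the value of everything skipped before the matched occurrence.
    refine ⟨Function.update ψ (4 + s) (ev φ c), k, ?_, ?_, ?_⟩
    · rw [Function.update_of_ne (by omega), h0]
    · rw [Function.update_of_ne (by omega), h1]
    · have e : ev (Function.update ψ (4 + s) (ev φ c)) (altList (s + 1) m) =
          ev ψ (altList (s + 1) m) := ev_congr fun d hd => Function.update_of_ne (by
        have := mem_altList hd
        omega) _ _
      have e' : Function.update ψ (4 + s) (ev φ c) (alt 0 1 s) = φ (alt a b s) := by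
        rcases alt_cases a b s with ⟨e₁, -, -, e₂, -⟩ | ⟨e₁, -, -, e₂, -⟩
        · rw [e₁, e₂, Function.update_of_ne (by omega), h0]
        · rw [e₁, e₂, Function.update_of_ne (by omega), h1]
      rw [altList_succ, ev_cons, ev_cons, e, e', Function.update_self, List.append_assoc,
        ev_append, List.cons_append, ev_cons, hk]
      simp only [mul_assoc]

/-- Every word is equivalent, before a tail in which enough letters recur, to a word with at most
two occurrences of each letter. -/
theorem exists_reduced (n : ℕ) (p : List ℕ) (hn : p.length ≤ n) :
    ∃ p' : List ℕ, (∀ z, p'.count z = min 2 (p.count z)) ∧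
      ∀ (M : Type u) [Monoid M], Base M → ∀ (φ : ℕ → M) (r : List ℕ),
        (∀ z ∈ p, 2 ≤ (p ++ r).count z) → ev φ (p ++ r) = ev φ (p' ++ r) := by
  induction n generalizing p with
  | zero =>
    obtain rfl : p = [] := List.length_eq_zero_iff.1 (by omega)
    exact ⟨[], by simp, fun _ _ _ _ _ _ => rfl⟩
  | succ n ih =>
    by_cases h : ∀ z, p.count z ≤ 2
    · exact ⟨p, fun z => (min_eq_right (h z)).symm, fun _ _ _ _ _ _ => rfl⟩
    push Not at h
    obtain ⟨z, hz⟩ := h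
    obtain ⟨p₁, p₂, rfl, hp₁⟩ := exists_first (List.count_pos_iff.1 (by omega : 0 < p.count z))
    rw [List.count_append, List.count_cons_self, List.count_eq_zero_of_not_mem hp₁] at hz
    obtain ⟨p₃, p₄, rfl, hp₃⟩ := exists_first (List.count_pos_iff.1 (by omega : 0 < p₂.count z))
    rw [List.count_append, List.count_cons_self, List.count_eq_zero_of_not_mem hp₃] at hz
    obtain ⟨p₅, p₆, rfl⟩ := List.append_of_mem
      (List.count_pos_iff.1 (by omega : 0 < p₄.count z))
    obtain ⟨p', hc, he⟩ := ih (p₁ ++ z :: (p₃ ++ (p₅ ++ z :: p₆))) (by simp at hn ⊢; omega)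
    have hcount : ∀ c, c ≠ z → (p₁ ++ z :: (p₃ ++ (p₅ ++ z :: p₆))).count c =
        (p₁ ++ z :: (p₃ ++ z :: (p₅ ++ z :: p₆))).count c := by
      intro c hcz
      simp [List.count_append, List.count_cons_of_ne (Ne.symm hcz)]
    refine ⟨p', fun c => ?_, fun M _ B φ r hr => ?_⟩
    · rw [hc]
      by_cases hcz : c = z
      · subst hcz
        simp only [List.count_append, List.count_cons_self]
        omega
      · rw [hcount c hcz]
    · have hr' : ∀ c ∈ p₁ ++ z :: (p₃ ++ (p₅ ++ z :: p₆)),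
          2 ≤ (p₁ ++ z :: (p₃ ++ (p₅ ++ z :: p₆)) ++ r).count c := by
        intro c hcm
        by_cases hcz : c = z
        · subst hcz
          simp only [List.count_append, List.count_cons_self]
          omega
        · rw [List.count_append, hcount c hcz, ← List.count_append]
          refine hr c ?_
          simp only [List.mem_append, List.mem_cons] at hcm ⊢
          tauto
      rw [← he M B φ r hr']
      -- Read from right to left, `spread` deletes the second of three chosen occurrences of z.
      have := B.spread φ (P := p₁ ++ z :: p₃) (s := p₅) (z := z) (r := p₆ ++ r) (by simp) (by
        intro c hcm
        simpa using hr' c (by simp [hcm]))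
      simpa using this.symm

/-- Before its first b, the word D can contain only copies of a, since a simple letter would show up
in the restriction; hence the prepended a or the last such copy meets b. -/
theorem isInfix_of_res {a b : ℕ} {T : Finset ℕ} (hab : a ≠ b) (ha : a ∉ T) (hb : b ∉ T)
    {D l : List ℕ} (hD : ∀ c ∈ D, c = a ∨ c = b ∨ c ∈ T) (h : res (insert b T) D = b :: l) :
    [a, b] <:+: a :: D := by
  induction D with
  | nil => simp at h
  | cons e D ih =>
    rcases hD e (by simp) with rfl | rfl | he
    · rw [res_cons_of_notMem (by simp [hab, ha])] at h
      exact (ih (fun c hc => hD c (by simp [hc])) h).trans (List.suffix_cons e _).isInfix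
    · exact ⟨[], D, by simp⟩
    · rw [res_cons_of_mem (by simp [he])] at h
      exact absurd he ((List.cons.inj h).1 ▸ hb)

/-- The two restrictions fix the positions of a and of b relative to the letters of T. Only the
mutual order of a and b inside a block could vary, and a block containing both would have ab or ba
as a factor. -/
theorem eq_of_res_eq {a b : ℕ} {T : Finset ℕ} (hab : a ≠ b) (ha : a ∉ T) (hb : b ∉ T)
    {D D' : List ℕ} (hD : ∀ c ∈ D, c = a ∨ c = b ∨ c ∈ T) (hD' : ∀ c ∈ D', c = a ∨ c = b ∨ c ∈ T)
    (h₁ : ¬ [a, b] <:+: D) (h₂ : ¬ [b, a] <:+: D)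
    (hra : res (insert a T) D = res (insert a T) D')
    (hrb : res (insert b T) D = res (insert b T) D') : D = D' := by
  have empty : ∀ {D : List ℕ}, (∀ c ∈ D, c = a ∨ c = b ∨ c ∈ T) → res (insert a T) D = [] →
      res (insert b T) D = [] → D = [] := by
    intro D hD h h'
    cases D with
    | nil => rfl
    | cons c D =>
      rcases hD c (by simp) with rfl | rfl | hc
      · simp [res] at h
      · simp [res] at h'
      · simp [res, hc] at h
  induction D generalizing D' with
  | nil => exact (empty hD' hra.symm hrb.symm).symm
  | cons c D ih =>
    cases D' with
    | nil => exact empty hD hra hrb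
    | cons d D' =>
      have hDt : ∀ e ∈ D, e = a ∨ e = b ∨ e ∈ T := fun e he => hD e (by simp [he])
      have hcd : c = d := by
        by_contra hcd
        rcases hD c (by simp) with rfl | rfl | hc
        · rcases hD' d (by simp) with rfl | rfl | hd
          · exact hcd rfl
          · rw [res_cons_of_notMem (by simp [hab, ha]), res_cons_of_mem (by simp)] at hrb
            exact h₁ (isInfix_of_res hab ha hb hDt hrb)
          · rw [res_cons_of_mem (by simp), res_cons_of_mem (by simp [hd])] at hra
            exact hcd (List.cons.inj hra).1
        · rcases hD' d (by simp) with rfl | rfl | hd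
          · rw [res_cons_of_notMem (by simp [hab.symm, hb]), res_cons_of_mem (by simp)] at hra
            exact h₂ (isInfix_of_res hab.symm hb ha (fun e he => by
              have := hDt e he; tauto) hra)
          · exact hcd rfl
          · rw [res_cons_of_mem (by simp), res_cons_of_mem (by simp [hd])] at hrb
            exact hcd (List.cons.inj hrb).1
        · rcases hD' d (by simp) with rfl | rfl | hd
          · rw [res_cons_of_mem (by simp [hc]), res_cons_of_mem (by simp)] at hra
            exact hcd (List.cons.inj hra).1
          · rw [res_cons_of_mem (by simp [hc]), res_cons_of_mem (by simp)] at hrb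
            exact hcd (List.cons.inj hrb).1
          · rw [res_cons_of_mem (by simp [hc]), res_cons_of_mem (by simp [hd])] at hra
            exact hcd (List.cons.inj hra).1
      subst hcd
      have strip : ∀ {A : Finset ℕ}, res A (c :: D) = res A (c :: D') → res A D = res A D' := by
        intro A h
        by_cases hc : c ∈ A
        · rw [res_cons_of_mem hc, res_cons_of_mem hc] at h
          exact (List.cons.inj h).2
        · rwa [res_cons_of_notMem hc, res_cons_of_notMem hc] at h
      rw [ih hDt (fun e he => hD' e (by simp [he]))
        (fun h => h₁ (h.trans (List.suffix_cons c D).isInfix))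
        (fun h => h₂ (h.trans (List.suffix_cons c D).isInfix)) (strip hra) (strip hrb)]

theorem exists_of_infix_res {A : Finset ℕ} {a b : ℕ} {l : List ℕ} (h : [a, b] <:+: res A l) :
    ∃ g m g', l = g ++ a :: (m ++ b :: g') ∧ ∀ c ∈ m, c ∉ A := by
  obtain ⟨s, t, h⟩ := h
  rw [List.append_assoc] at h
  obtain ⟨l₁, l₂, rfl, -, h₂⟩ := List.filter_eq_append_iff.1 h.symm
  simp only [List.cons_append, List.nil_append] at h₂
  obtain ⟨m₁, m₂, rfl, -, -, h₃⟩ := List.filter_eq_cons_iff.1 h₂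
  obtain ⟨m₃, m₄, rfl, hm, -, -⟩ := List.filter_eq_cons_iff.1 h₃
  exact ⟨l₁ ++ m₁, m₃, m₄, by simp, by simpa using hm⟩

/-- The renaming of `a` and any other letter to `0` and `1`. -/
def ren (a c : ℕ) : ℕ := if c = a then 0 else 1

section ren
variable {a b : ℕ} (hab : a ≠ b) (l : List ℕ)

theorem count_ren_zero : ((res {a, b} l).map (ren a)).count 0 = l.count a := by
  induction l with
  | nil => rfl
  | cons c l ih =>
    by_cases hc : c = a
    · subst hc
      rw [res_cons_of_mem (by simp)]
      simp [ren, ih]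
    · by_cases hc' : c = b
      · subst hc'
        rw [res_cons_of_mem (by simp)]
        simp [ren, ih, hc]
      · rw [res_cons_of_notMem (by simp [hc, hc']), ih]
        simp [hc]

include hab in
theorem count_ren_one : ((res {a, b} l).map (ren a)).count 1 = l.count b := by
  induction l with
  | nil => rfl
  | cons c l ih =>
    by_cases hc : c = a
    · subst hc
      rw [res_cons_of_mem (by simp)]
      simp [ren, ih, hab]
    · by_cases hc' : c = b
      · subst hc'
        rw [res_cons_of_mem (by simp)]
        simp [ren, ih, hc]
      · rw [res_cons_of_notMem (by simp [hc, hc']), ih]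
        simp [hc']

theorem mem_ren {z : ℕ} (h : z ∈ (res {a, b} l).map (ren a)) : z = 0 ∨ z = 1 := by
  rw [List.mem_map] at h
  obtain ⟨c, -, rfl⟩ := h
  unfold ren
  split_ifs <;> simp

include hab in
theorem ev_ren {M : Type u} [Monoid M] {φ ψ : ℕ → M} (h0 : ψ 0 = φ a) (h1 : ψ 1 = φ b) :
    ev ψ ((res {a, b} l).map (ren a)) = ev φ (res {a, b} l) := by
  induction l with
  | nil => rfl
  | cons c l ih =>
    by_cases hc : c = a
    · subst hc
      rw [res_cons_of_mem (by simp)]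
      simp [ren, ih, h0]
    · by_cases hc' : c = b
      · subst hc'
        rw [res_cons_of_mem (by simp)]
        simp [ren, ih, hc, h1]
      · rwa [res_cons_of_notMem (by simp [hc, hc'])]

include hab in
theorem flatMap_ren {f : ℕ → List ℕ} (ha : f a = [0]) (hb : f b = [1])
    (h : ∀ c ∈ l, c ≠ a → c ≠ b → f c = []) :
    l.flatMap f = (res {a, b} l).map (ren a) := by
  induction l with
  | nil => rfl
  | cons c l ih =>
    have ih := ih fun d hd => h d (by simp [hd])
    by_cases hc : c = a
    · subst hc
      rw [res_cons_of_mem (by simp)]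
      simp [ren, ih, ha]
    · by_cases hc' : c = b
      · subst hc'
        rw [res_cons_of_mem (by simp)]
        simp [ren, ih, hc, hb]
      · rw [res_cons_of_notMem (by simp [hc, hc']), List.flatMap_cons, ih,
          h c (by simp) hc hc', List.nil_append]

end ren

/-! ### Two-letter consequences of an identity -/

namespace Approx
variable {V W : MonoidClass.{u}} (hVW : Approx V W)
include hVW

/-- Removes the upper bound on the number of occurrences: by `exists_reduced` the base identities
alone cut `p` and `q` down to at most two occurrences of each letter. -/
theorem tail_holds {p q c : List ℕ} (hp : ∀ z ∈ p, z = 0 ∨ z = 1) (hq : ∀ z ∈ q, z = 0 ∨ z = 1)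
    (hc : IsTail c)
    (hcount : ∀ z, z = 0 ∨ z = 1 →
      1 ≤ p.count z ∧ p.count z = q.count z ∧ 2 ≤ (q ++ c).count z)
    (h : Holds V (p ++ c) (q ++ c)) : Holds W (p ++ c) (q ++ c) := by
  obtain ⟨p', hp', ep⟩ := exists_reduced.{u} _ p le_rfl
  obtain ⟨q', hq', eq⟩ := exists_reduced.{u} _ q le_rfl
  have Ep : ∀ (M : Type u) [Monoid M], Base M → ∀ φ : ℕ → M, ev φ (p ++ c) = ev φ (p' ++ c) := by
    intro M _ B φ
    refine ep M B φ c fun z hz => ?_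
    have := hcount z (hp z hz)
    rw [List.count_append] at this ⊢
    omega
  have Eq : ∀ (M : Type u) [Monoid M], Base M → ∀ φ : ℕ → M, ev φ (q ++ c) = ev φ (q' ++ c) := by
    intro M _ B φ
    exact eq M B φ c fun z hz => (hcount z (hq z hz)).2.2
  have sub : ∀ {l l' : List ℕ}, (∀ z, l'.count z = min 2 (l.count z)) →
      (∀ z ∈ l, z = 0 ∨ z = 1) → ∀ z ∈ l', z = 0 ∨ z = 1 := by
    intro l l' h1 h2 z hz
    refine h2 z ?_
    rw [← List.count_pos_iff] at hz ⊢
    have := h1 z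
    omega
  have main : Holds W (p' ++ c) (q' ++ c) := by
    refine hVW.tail p' q' c (sub hp' hp) (sub hq' hq) hc (fun z hz => ?_) fun M _ hM φ => ?_
    · have := hcount z hz
      rw [List.count_append] at this ⊢
      rw [hp', hq']
      omega
    · rw [← Ep M (hVW.baseV M hM), ← Eq M (hVW.baseV M hM)]
      exact h M hM φ
  intro M _ hM φ
  rw [Ep M (hVW.base M hM), Eq M (hVW.base M hM)]
  exact main M hM φ

/-- The two-letter consequence of an identity of `V`, cut after some block, holds in `W`. -/
theorem pair {T : Finset ℕ} {a b : ℕ} {p q r r' : List ℕ} (h : Linked V T (p ++ r) (q ++ r'))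
    (hab : a ≠ b) (ha : a ∉ T) (hb : b ∉ T)
    (hra : res (insert a T) r = res (insert a T) r')
    (hrb : res (insert b T) r = res (insert b T) r')
    (hr : r = [] ∨ ∃ t r₁, t ∈ T ∧ r = t :: r₁) (hr' : r' = [] ∨ ∃ t r₁, t ∈ T ∧ r' = t :: r₁)
    (hap : a ∈ p) (hbp : b ∈ p) (hca : p.count a = q.count a) (hcb : p.count b = q.count b)
    (M : Type u) [Monoid M] (hM : W M) (φ : ℕ → M) (P B : List ℕ)
    (hmul : ∀ z ∈ r, z ∉ T → z ≠ a → z ≠ b → 2 ≤ (P ++ B ++ r).count z) :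
    ev φ (P ++ res {a, b} p ++ B ++ r) = ev φ (P ++ res {a, b} q ++ B ++ r) := by
  have haq : a ∈ q := by rw [← List.count_pos_iff] at hap ⊢; omega
  have hbq : b ∈ q := by rw [← List.count_pos_iff] at hbp ⊢; omega
  have hca' : r.count a = r'.count a := by
    rw [← count_res (Finset.mem_insert_self a T), hra, count_res (Finset.mem_insert_self a T)]
  have hcb' : r.count b = r'.count b := by
    rw [← count_res (Finset.mem_insert_self b T), hrb, count_res (Finset.mem_insert_self b T)]
  set p₀ := (res {a, b} p).map (ren a) with hp₀
  set q₀ := (res {a, b} q).map (ren a) with hq₀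
  -- simple letters after the cut do not occur before it
  have disj : ∀ t ∈ T, t ∈ r → t ∉ p ∧ t ∉ q := by
    intro t ht htr
    have htr' : t ∈ r' := by
      have : t ∈ res (insert a T) r := mem_res.2 ⟨htr, by simp [ht]⟩
      rw [hra] at this
      exact (mem_res.1 this).1
    have h1 := h.simple_left t ht
    have h2 := h.simple_right t ht
    rw [List.count_append] at h1 h2
    rw [← List.count_pos_iff] at htr htr'
    exact ⟨List.count_eq_zero.1 (by omega), List.count_eq_zero.1 (by omega)⟩
  have lift : ∀ c, IsTail c → (a ∈ r → 0 ∈ c) → (b ∈ r → 1 ∈ c) →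
      Holds V (p₀ ++ c) (q₀ ++ c) → Holds W (p₀ ++ c) (q₀ ++ c) := by
    intro c hc h0 h1
    refine hVW.tail_holds (fun z => mem_ren p) (fun z => mem_ren q) hc fun z hz => ?_
    have repeated : ∀ z, z ∈ p → z ∉ T → p.count z = q.count z →
        2 ≤ q.count z ∨ z ∈ r := by
      intro z hz hzT he
      have := h.repeated_left z (by simp [hz]) hzT
      rw [List.count_append] at this
      by_cases hzr : z ∈ r
      · exact Or.inr hzr
      · rw [List.count_eq_zero_of_not_mem hzr] at this
        exact Or.inl (by omega)
    have hap' := List.count_pos_iff.2 hap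
    have hbp' := List.count_pos_iff.2 hbp
    rcases hz with rfl | rfl
    · rw [List.count_append, hp₀, hq₀, count_ren_zero, count_ren_zero]
      refine ⟨by omega, hca, ?_⟩
      rcases repeated a hap ha hca with h | h
      · omega
      · have := List.count_pos_iff.2 (h0 h)
        omega
    · rw [List.count_append, hp₀, hq₀, count_ren_one hab, count_ren_one hab]
      refine ⟨by omega, hcb, ?_⟩
      rcases repeated b hbp hb hcb with h | h
      · omega
      · have := List.count_pos_iff.2 (h1 h)
        omega
  have hap₀ : 0 ∈ p₀ := List.count_pos_iff.1 (by
    rw [hp₀, count_ren_zero]; exact List.count_pos_iff.2 hap)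
  have hbp₀ : 1 ∈ p₀ := List.count_pos_iff.1 (by
    rw [hp₀, count_ren_one hab]; exact List.count_pos_iff.2 hbp)
  have haq₀ : 0 ∈ q₀ := List.count_pos_iff.1 (by
    rw [hq₀, count_ren_zero]; exact List.count_pos_iff.2 haq)
  have hbq₀ : 1 ∈ q₀ := List.count_pos_iff.1 (by
    rw [hq₀, count_ren_one hab]; exact List.count_pos_iff.2 hbq)
  -- It suffices to realise `B ++ r`, after any prefix that contains a and b and at least the
  -- letters of `P`, as an instance of the tail c followed by some k.
  have conclude : ∀ (c : List ℕ) (ψ : ℕ → M) (k : M), Holds W (p₀ ++ c) (q₀ ++ c) →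
      ψ 0 = φ a → ψ 1 = φ b →
      (∀ P' : List ℕ, a ∈ P' → b ∈ P' → (∀ z, P.count z ≤ P'.count z) →
        ev φ (P' ++ B ++ r) = ev φ P' * ev ψ c * k) →
      ev φ (P ++ res {a, b} p ++ B ++ r) = ev φ (P ++ res {a, b} q ++ B ++ r) := by
    intro c ψ k hW h0 h1 hB
    have e := hW M hM ψ
    rw [ev_append, ev_append, hp₀, hq₀, ev_ren hab p h0 h1, ev_ren hab q h0 h1] at e
    rw [hB (P ++ res {a, b} p) (by simp [hap]) (by simp [hbp]) (by simp),
      hB (P ++ res {a, b} q) (by simp [haq]) (by simp [hbq]) (by simp)]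
    have e' := congrArg (fun g => ev φ P * (g * k)) e
    simp only [ev_append, mul_assoc] at e' ⊢
    exact e'
  have hBM := hVW.base M hM
  by_cases hboth : [a, b] <:+: res (insert a (insert b T)) r ∨
      [b, a] <:+: res (insert a (insert b T)) r
  · -- some later block contains both letters
    have hcab : a ∈ r ∧ b ∈ r := by
      rcases hboth with h | h <;>
        exact ⟨(mem_res.1 (h.subset (by simp))).1, (mem_res.1 (h.subset (by simp))).1⟩
    have hcab' : a ∈ r' ∧ b ∈ r' := by
      refine ⟨?_, ?_⟩ <;> rw [← List.count_pos_iff]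
      · rw [← hca']; exact List.count_pos_iff.2 hcab.1
      · rw [← hcb']; exact List.count_pos_iff.2 hcab.2
    -- The first simple letter after the cut becomes t, and all letters except a, b and t are
    -- erased. What follows t then contains both letters, each already seen, so `eq_two` reduces it
    -- to xy.
    have hV : Holds V (p₀ ++ [3, 0, 1]) (q₀ ++ [3, 0, 1]) := by
      obtain ⟨t, r₁, ht, rfl⟩ := hr.resolve_left (by rintro rfl; simp at hcab)
      obtain ⟨t', r₁', ht', rfl⟩ := hr'.resolve_left (by rintro rfl; simp at hcab')
      have htt : t = t' := by
        rw [res_cons_of_mem (by simp [ht]), res_cons_of_mem (by simp [ht'])] at hra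
        exact (List.cons.inj hra).1
      subst htt
      have hta : t ≠ a := fun e => ha (e ▸ ht)
      have htb : t ≠ b := fun e => hb (e ▸ ht)
      obtain ⟨htp, htq⟩ := disj t ht (by simp)
      have htr : t ∉ r₁ := by
        have := h.simple_left t ht
        rw [List.count_append, List.count_cons_self] at this
        exact List.count_eq_zero.1 (by omega)
      have htr' : t ∉ r₁' := by
        have := h.simple_right t ht
        rw [List.count_append, List.count_cons_self] at this
        exact List.count_eq_zero.1 (by omega)
      let f : ℕ → List ℕ := fun c => if c = a then [0] else if c = b then [1] else
        if c = t then [3] else []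
      have fa : f a = [0] := by simp [f]
      have fb : f b = [1] := by simp [f, hab.symm]
      have ft : f t = [3] := by simp [f, hta, htb]
      have f0 : ∀ l : List ℕ, t ∉ l → ∀ c ∈ l, c ≠ a → c ≠ b → f c = [] := by
        intro l hl c hc h1 h2
        have : c ≠ t := fun e => hl (e ▸ hc)
        simp [f, h1, h2, this]
      have hs := h.holds.subst f
      rw [List.flatMap_append, List.flatMap_append, flatMap_ren hab p fa fb (f0 p htp),
        flatMap_ren hab q fa fb (f0 q htq), List.flatMap_cons, List.flatMap_cons, ft,
        flatMap_ren hab r₁ fa fb (f0 r₁ htr), flatMap_ren hab r₁' fa fb (f0 r₁' htr')] at hs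
      have simp_tail : ∀ {N : Type u} [Monoid N], V N → ∀ (χ : ℕ → N) (s l : List ℕ), 0 ∈ s → 1 ∈ s →
          a ∈ l → b ∈ l → ev χ (s ++ ([3] ++ (res {a, b} l).map (ren a))) =
            ev χ (s ++ [3, 0, 1]) := by
        intro N _ hN χ s l hs0 hs1 hal hbl
        have := (hVW.baseV N hN).eq_two χ (P := s ++ [3]) (m := (res {a, b} l).map (ren a))
          (a := 0) (b := 1)
          (List.count_pos_iff.1 (by rw [count_ren_zero]; exact List.count_pos_iff.2 hal))
          (List.count_pos_iff.1 (by rw [count_ren_one hab]; exact List.count_pos_iff.2 hbl))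
          (fun c => mem_ren l) (by simp [hs0]) (by simp [hs1])
        simpa [mul_assoc] using this
      have har : a ∈ r₁ ∧ b ∈ r₁ := by simpa [hta.symm, htb.symm] using hcab
      have har' : a ∈ r₁' ∧ b ∈ r₁' := by simpa [hta.symm, htb.symm] using hcab'
      intro N _ hN χ
      have := hs N hN χ
      rwa [simp_tail hN χ _ _ hap₀ hbp₀ har.1 har.2,
        simp_tail hN χ _ _ haq₀ hbq₀ har'.1 har'.2] at this
    have hW := lift [3, 0, 1] (Or.inl rfl) (by simp) (by simp) hV
    -- Letters between a and b in a later block are repeated, so b spreads back until it stands next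
    -- to a. This exposes the factor xy, with t taking the value of `B ++ g`.
    have spread : ∀ {a b : ℕ} {g m g' : List ℕ}, r = g ++ a :: (m ++ b :: g') →
        (∀ c ∈ m, 2 ≤ (P ++ B ++ r).count c) → ∀ P' : List ℕ, b ∈ P' →
        (∀ z, P.count z ≤ P'.count z) →
        ev φ (P' ++ B ++ r) = ev φ (P' ++ B ++ g) * φ a * φ b * ev φ (m ++ b :: g') := by
      intro a b g m g' hr hm P' hbP hcount
      have := hBM.spread φ (P := P' ++ B ++ g ++ [a]) (s := m) (z := b) (r := g') (by simp [hbP])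
        (by
          intro c hc
          refine (hm c hc).trans ?_
          rw [hr]
          have := hcount c
          simp only [List.count_append, List.count_cons, List.count_nil]
          omega)
      rw [hr]
      simpa [mul_assoc] using this
    have mul : ∀ {m : List ℕ}, (∀ c ∈ m, c ∉ insert a (insert b T)) → (∀ c ∈ m, c ∈ r) →
        ∀ c ∈ m, 2 ≤ (P ++ B ++ r).count c := by
      intro m hm hmr c hc
      have := hm c hc
      simp only [Finset.mem_insert, not_or] at this
      exact hmul c (hmr c hc) this.2.2 this.1 this.2.1
    rcases hboth with hinf | hinf
    · obtain ⟨g, m, g', hg, hm⟩ := exists_of_infix_res hinf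
      refine conclude _ (fun n => if n = 0 then φ a else if n = 1 then φ b else ev φ (B ++ g))
        (ev φ (m ++ b :: g')) hW (by simp) (by simp) fun P' haP hbP hc => ?_
      rw [spread hg (mul hm (by rw [hg]; simp +contextual)) P' hbP hc]
      simp [mul_assoc]
    · obtain ⟨g, m, g', hg, hm⟩ := exists_of_infix_res hinf
      refine conclude _ (fun n => if n = 0 then φ a else if n = 1 then φ b else ev φ (B ++ g))
        (ev φ (m ++ a :: g')) hW (by simp) (by simp) fun P' haP hbP hc => ?_
      have hm' := mul hm (by rw [hg]; simp +contextual)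
      rw [spread hg hm' P' haP hc,
        hBM.comm (has_ev φ (by simp [hbP])) (has_ev φ (by simp [haP]))]
      simp [mul_assoc]
  · push Not at hboth
    set D := res (insert a (insert b T)) r with hD
    have hDr : ∀ c ∈ D, c ∈ r ∧ (c = a ∨ c = b ∨ c ∈ T) := fun c hc => by
      simpa using mem_res.1 hc
    have sa : insert a T ⊆ insert a (insert b T) :=
      Finset.insert_subset_insert a (Finset.subset_insert b T)
    have sb : insert b T ⊆ insert a (insert b T) := Finset.subset_insert a _
    -- With no block of `r` containing both letters, the remainders agree on a, b and the simple
    -- letters, so one substitution compresses both.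
    have hDD : D = res (insert a (insert b T)) r' :=
      eq_of_res_eq hab ha hb (fun c hc => (hDr c hc).2)
        (fun c hc => by simpa using (mem_res.1 hc).2) hboth.1 hboth.2
        (by rw [hD, res_res sa, res_res sa, hra]) (by rw [hD, res_res sb, res_res sb, hrb])
    obtain ⟨f, s, m, hs, fa, fb, f0, hsub, hmem, hev⟩ := exists_compression.{u} hab D
      (by
        intro t htD hta htb
        have ht : t ∈ T := by simpa [hta, htb] using (hDr t htD).2
        have h1 := h.simple_left t ht
        have h2 := List.count_pos_iff.2 (hDr t htD).1
        rw [List.count_append] at h1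
        rw [hD, count_res (by simp [ht])]
        omega)
      hboth.1 hboth.2
      (by
        rcases hr with hr | ⟨t, r₁, ht, hr⟩
        · simp [hD, hr]
        · have hta : t ≠ a := fun e => ha (e ▸ ht)
          have htb : t ≠ b := fun e => hb (e ▸ ht)
          rw [hD, hr, res_cons_of_mem (by simp [ht])]
          simp [hta, htb])
    have fp : ∀ l : List ℕ, (∀ t ∈ T, t ∈ r → t ∉ l) → ∀ c ∈ l, c ≠ a → c ≠ b → f c = [] := by
      intro l hl c hc hca hcb
      refine f0 c (fun hcD => ?_) hca hcb
      have hcT : c ∈ T := by simpa [hca, hcb] using (hDr c hcD).2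
      exact hl c hcT (hDr c hcD).1 hc
    have fr : ∀ l : List ℕ, l.flatMap f = (res (insert a (insert b T)) l).flatMap f := by
      intro l
      refine (flatMap_res fun c _ hc => ?_).symm
      simp only [Finset.mem_insert, not_or] at hc
      refine f0 c (fun hcD => ?_) hc.1 hc.2.1
      have := (hDr c hcD).2
      tauto
    have hV : Holds V (p₀ ++ altList s m) (q₀ ++ altList s m) := by
      have hs := h.holds.subst f
      rw [List.flatMap_append, List.flatMap_append,
        flatMap_ren hab p fa fb (fp p fun t ht htr => (disj t ht htr).1),
        flatMap_ren hab q fa fb (fp q fun t ht htr => (disj t ht htr).2), fr r, fr r', ← hDD,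
        ← hD] at hs
      intro N _ hN χ
      have := hs N hN χ
      rw [ev_append, ev_append, hev N (hVW.baseV N hN) χ _ (has_ev χ hap₀) (has_ev χ hbp₀),
        hev N (hVW.baseV N hN) χ _ (has_ev χ haq₀) (has_ev χ hbq₀)] at this
      rw [ev_append, ev_append, this]
    have alt_mem : ∀ z, z = a ∨ z = b → z ∈ r → ∃ i ∈ List.range' s m, alt a b i = z := by
      intro z hz hzr
      have := hmem z (mem_res.2 ⟨hzr, by rcases hz with rfl | rfl <;> simp⟩) hz
      simpa using this
    have hW := lift (altList s m) (Or.inr ⟨s, m, hs, rfl⟩)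
      (fun har => by
        obtain ⟨i, hi, hia⟩ := alt_mem a (Or.inl rfl) har
        have := alt_mem_altList hi
        rcases alt_cases a b i with ⟨-, -, -, e, -⟩ | ⟨e, -⟩
        · rwa [e] at this
        · exact absurd (hia.symm.trans e) hab)
      (fun hbr => by
        obtain ⟨i, hi, hib⟩ := alt_mem b (Or.inr rfl) hbr
        have := alt_mem_altList hi
        rcases alt_cases a b i with ⟨e, -⟩ | ⟨-, -, -, e, -⟩
        · exact absurd (e.symm.trans hib) hab
        · rwa [e] at this) hV
    -- In `W` the compressed tail is matched against the full `B ++ r`; the letters tᵢ take up the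
    -- letters in between, including `B`.
    obtain ⟨ψ, k, h0, h1, hk⟩ := exists_match φ a b m s (B ++ r)
      (hsub.trans (List.filter_sublist.trans (List.sublist_append_right B r)))
    refine conclude _ ψ k hW h0 h1 fun P' _ _ _ => ?_
    rw [List.append_assoc, ev_append, hk, mul_assoc]

end Approx

/-! ### Interchanging two adjacent letters of a block -/

theorem append_inj_of_block {T : Finset ℕ} {X X' Y Y' : List ℕ} (hX : ∀ c ∈ X, c ∉ T)
    (hX' : ∀ c ∈ X', c ∉ T) (hY : Y = [] ∨ ∃ t Y₁, t ∈ T ∧ Y = t :: Y₁)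
    (hY' : Y' = [] ∨ ∃ t Y₁, t ∈ T ∧ Y' = t :: Y₁) (h : X ++ Y = X' ++ Y') :
    X = X' ∧ Y = Y' := by
  induction X generalizing X' with
  | nil =>
    cases X' with
    | nil => exact ⟨rfl, h⟩
    | cons c X' =>
      rcases hY with rfl | ⟨t, Y₁, ht, rfl⟩
      · simp at h
      · simp only [List.nil_append, List.cons_append, List.cons.injEq] at h
        exact absurd (h.1 ▸ ht) (hX' c (by simp))
  | cons d X ih =>
    cases X' with
    | nil =>
      rcases hY' with rfl | ⟨t, Y₁, ht, rfl⟩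
      · simp at h
      · simp only [List.nil_append, List.cons_append, List.cons.injEq] at h
        exact absurd (h.1 ▸ ht) (hX d (by simp))
    | cons c X' =>
      simp only [List.cons_append, List.cons.injEq] at h
      obtain ⟨rfl, h⟩ := h
      obtain ⟨h₁, h₂⟩ := ih (fun e he => hX e (by simp [he])) (fun e he => hX' e (by simp [he])) h
      exact ⟨by rw [h₁], h₂⟩

section pairs
variable {a b : ℕ} (hab : a ≠ b) (l : List ℕ)

include hab in
theorem filter_res_left : (res {a, b} l).filter (· ≠ a) = List.replicate (l.count b) b := by
  rw [List.eq_replicate_iff]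
  constructor
  · rw [← count_res (A := {a, b}) (c := b) (by simp) l, List.count_eq_length_filter]
    congr 1
    refine List.filter_congr fun c hc => ?_
    have : c = a ∨ c = b := by simpa using (mem_res.1 hc).2
    rcases this with rfl | rfl
    · simp [hab]
    · simp [hab.symm]
  · intro c hc
    simp only [List.mem_filter, mem_res, Finset.mem_insert, Finset.mem_singleton] at hc
    simpa [by simpa using hc.2] using hc.1.2

include hab in
theorem filter_res_right : (res {a, b} l).filter (· ≠ b) = List.replicate (l.count a) a := by
  rw [Finset.pair_comm]
  exact filter_res_left hab.symm l

include hab in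
theorem res_of_notMem_left (h : a ∉ l) : res {a, b} l = List.replicate (l.count b) b := by
  rw [← filter_res_left hab, List.filter_eq_self.2]
  intro c hc
  have : c ≠ a := fun e => h (e ▸ (mem_res.1 hc).1)
  simpa using this

include hab in
theorem res_of_notMem_right (h : b ∉ l) : res {a, b} l = List.replicate (l.count a) a := by
  rw [Finset.pair_comm]
  exact res_of_notMem_left hab.symm l h

end pairs

namespace Base
variable {M : Type u} [Monoid M] (hM : Base M) (φ : ℕ → M)
include hM

theorem insert {P B r : List ℕ} {z : ℕ} (hz : z ∈ P) (hzB : z ∈ B)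
    (hc : ∀ c ∈ B, 2 ≤ (P ++ B ++ r).count c) :
    ev φ (P ++ B ++ r) = ev φ (P ++ z :: B ++ r) := by
  obtain ⟨B₁, B₂, rfl⟩ := List.append_of_mem hzB
  have := hM.spread φ (P := P) (s := B₁) (z := z) (r := B₂ ++ r) hz (by
    intro c hcm
    simpa using hc c (by simp [hcm]))
  simpa using this

theorem delete_block {P m m' B r : List ℕ} {z : ℕ} (hz : z ∈ P) (hzB : z ∈ B)
    (hm : m.filter (· ≠ z) = m') (hc : ∀ c ∈ m ++ B, 2 ≤ (P ++ m' ++ B ++ r).count c) :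
    ev φ (P ++ m ++ B ++ r) = ev φ (P ++ m' ++ B ++ r) := by
  subst hm
  obtain ⟨B₁, B₂, rfl⟩ := List.append_of_mem hzB
  have := hM.delete φ (P := P) (m := m) (s := B₁) (z := z) (r := B₂ ++ r) hz (by
    intro c hcm
    have := hc c (by simp only [List.mem_append, List.mem_cons] at hcm ⊢; tauto)
    simpa using this)
  simpa using this

theorem absorb_replicate {Q B r : List ℕ} {z : ℕ} (n : ℕ) (hz : z ∈ Q) (hn : z ∈ B ∨ n = 0)
    (hc : ∀ c ∈ B, 2 ≤ (Q ++ B ++ r).count c) :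
    ev φ (Q ++ List.replicate n z ++ B ++ r) = ev φ (Q ++ B ++ r) := by
  rcases hn with hn | rfl
  · have := hM.delete_block φ (P := Q) (m := List.replicate n z) (m' := []) (B := B) (r := r) hz
      hn (by simp) (by
        intro c hcm
        rw [List.append_nil]
        refine hc c ?_
        simp only [List.mem_append, List.mem_replicate] at hcm
        rcases hcm with ⟨-, rfl⟩ | h
        exacts [hn, h])
    simpa using this
  · simp

theorem erase {Q m m' R : List ℕ} {z : ℕ} (hz : z ∈ Q) (hm : m.filter (· ≠ z) = m')
    (hc : ∀ c ∈ m, 2 ≤ (Q ++ m' ++ [z] ++ R).count c) :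
    ev φ (Q ++ m ++ [z] ++ R) = ev φ (Q ++ m' ++ [z] ++ R) := by
  refine hM.delete_block φ hz (by simp) hm fun c hcm => ?_
  rcases List.mem_append.1 hcm with h | h
  · exact hc c h
  · obtain rfl : c = z := by simpa using h
    have := List.count_pos_iff.2 hz
    simp only [List.count_append, List.count_cons_self]
    omega

section swap
variable {a b : ℕ} {P B r : List ℕ}
  (hmul : ∀ c, c = a ∨ c = b ∨ c ∈ B →
    2 ≤ P.count c + [a].count c + [b].count c + B.count c + r.count c)
include hmul

/-- Both sides equal the word with this b removed: as b occurs before and recurs in `B`, it may be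
inserted on either side of a. -/
theorem swap_of_recur (hbP : b ∈ P) (hbB : b ∈ B) :
    ev φ (P ++ [b, a] ++ B ++ r) = ev φ (P ++ [a, b] ++ B ++ r) := by
  have key : ∀ c, c = a ∨ c ∈ B → 2 ≤ (P ++ (a :: B) ++ r).count c := by
    intro c hc
    have h := hmul c (by tauto)
    simp only [List.count_append, List.count_cons, List.count_nil] at h ⊢
    by_cases hcb : c = b
    · subst hcb
      have h1 := List.count_pos_iff.2 hbP
      have h2 := List.count_pos_iff.2 hbB
      omega
    · have : (b == c) = false := by simpa using Ne.symm hcb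
      simp only [this] at h
      simp at h ⊢
      omega
  have e₁ := hM.insert φ (P := P) (B := a :: B) (r := r) (z := b) hbP (by simp [hbB])
    fun c hc => key c (by simpa using hc)
  have e₂ := hM.insert φ (P := P ++ [a]) (B := B) (r := r) (z := b) (by simp [hbP]) hbB
    fun c hc => by simpa using key c (Or.inr hc)
  simp only [List.append_assoc, List.cons_append, List.nil_append] at e₁ e₂ ⊢
  rw [← e₁, ← e₂]

/-- Since both letters recur in `B`, the factors ba and ab may be replaced by their squares, which
`sq_comm` identifies. -/
theorem swap_of_both (haB : a ∈ B) (hbB : b ∈ B) :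
    ev φ (P ++ [b, a] ++ B ++ r) = ev φ (P ++ [a, b] ++ B ++ r) := by
  have key : ∀ Q : List ℕ, (∀ c, P.count c + [a].count c + [b].count c ≤ Q.count c) →
      ∀ c ∈ B, 2 ≤ (Q ++ B ++ r).count c := by
    intro Q hQ c hc
    have h := hmul c (Or.inr (Or.inr hc))
    have h' := hQ c
    simp only [List.count_append]
    omega
  have double : ∀ c d : ℕ, c ∈ B → d ∈ B → (∀ z, [c].count z + [d].count z =
      [a].count z + [b].count z) →
      ev φ (P ++ [c, d] ++ B ++ r) = ev φ P * (φ c * φ d * (φ c * φ d)) * ev φ (B ++ r) := by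
    intro c d hc hd hcd
    have e₁ := hM.insert φ (P := P ++ [c, d]) (B := B) (r := r) (z := d) (by simp) hd
      (key _ fun z => by
        have := hcd z
        simp only [List.count_append, List.count_cons, List.count_nil] at this ⊢
        omega)
    have e₂ := hM.insert φ (P := P ++ [c, d]) (B := d :: B) (r := r) (z := c) (by simp)
      (by simp [hc]) (by
        intro z hz
        have := hcd z
        have h := hmul z
        by_cases hzB : z ∈ B
        · have h := h (Or.inr (Or.inr hzB))
          simp only [List.count_append, List.count_cons, List.count_nil] at this h ⊢
          omega
        · obtain rfl : z = d := by simpa [hzB] using hz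
          exact absurd hd hzB)
    rw [e₁, e₂]
    simp [mul_assoc]
  rw [double b a hbB haB fun z => by omega, double a b haB hbB fun z => by omega, hM.sq_comm]

-- In `hpair` the two-letter consequence is multiplied on the left by the true prefix `P` and
-- followed by the rest of the word. In its application in `Approx.swap`, `B'` is the rest of the
-- corresponding block on the other side.
variable {w B' : List ℕ} (hab : a ≠ b)
  (hpair : ev φ (P ++ (res {a, b} P ++ [b, a] ++ res {a, b} B) ++ B ++ r) =
    ev φ (P ++ (res {a, b} w ++ [a] ++ res {a, b} B') ++ B ++ r))
  (cntA : B.count a = B'.count a)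
include hab hpair cntA

/-- Here `hpair` reads P·aⁱ·ba·bⁿ·B·r = P·aʲ·a·b·bⁿ·B·r. Since a occurs in `P`, its copies before
another a are erased, and bⁿ is absorbed by `B`. -/
theorem swap_of_first_right (haP : a ∈ P) (hbP : b ∉ P) (haB : a ∉ B) (hbw : b ∉ w)
    (cntB : B'.count b = B.count b + 1) :
    ev φ (P ++ [b, a] ++ B ++ r) = ev φ (P ++ [a, b] ++ B ++ r) := by
  have haB' : a ∉ B' := by
    rw [← List.count_pos_iff, cntA.symm, List.count_pos_iff] at *
    exact haB
  have hn : b ∈ B ∨ B.count b = 0 := by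
    by_cases hbB : b ∈ B
    · exact Or.inl hbB
    · exact Or.inr (List.count_eq_zero_of_not_mem hbB)
  have key : ∀ X : List ℕ, (∀ c, P.count c + [a].count c + [b].count c + B.count c + r.count c ≤
      X.count c) → ∀ c, c = a ∨ c = b ∨ c ∈ B → 2 ≤ X.count c :=
    fun X hX c hc => (hmul c hc).trans (hX c)
  rw [res_of_notMem_left hab B haB, res_of_notMem_left hab B' haB', cntB,
    List.replicate_succ] at hpair
  have e₁ := hM.absorb_replicate φ (Q := P ++ res {a, b} P ++ [b, a]) (B := B) (r := r) (z := b)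
    (B.count b) (by simp) hn fun c hc => key _ (fun c => by
      simp only [List.count_append, List.count_cons, List.count_nil]
      omega) c (Or.inr (Or.inr hc))
  have e₂ := hM.erase φ (Q := P) (m := res {a, b} P ++ [b]) (m' := [b]) (R := B ++ r) haP
    (by rw [List.filter_append, filter_res_left hab, List.count_eq_zero_of_not_mem hbP]
        simp [hab.symm])
    fun c hc => key _ (fun c => by
      simp only [List.count_append, List.count_cons, List.count_nil]
      omega) c (by
        have : c = a ∨ c = b := by
          simp only [List.mem_append, mem_res, Finset.mem_insert, Finset.mem_singleton,
            List.mem_cons, List.not_mem_nil, or_false] at hc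
          clear hpair e₁ key hmul
          tauto
        clear hpair e₁ key hmul
        tauto)
  have e₃ := hM.absorb_replicate φ (Q := P ++ res {a, b} w ++ [a, b]) (B := B) (r := r) (z := b)
    (B.count b) (by simp) hn fun c hc => key _ (fun c => by
      simp only [List.count_append, List.count_cons, List.count_nil]
      omega) c (Or.inr (Or.inr hc))
  have e₄ := hM.erase φ (Q := P) (m := res {a, b} w) (m' := []) (R := [b] ++ B ++ r) haP
    (by rw [filter_res_left hab, List.count_eq_zero_of_not_mem hbw]; rfl)
    fun c hc => key _ (fun c => by
      simp only [List.count_append, List.count_cons, List.count_nil]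
      omega) c (by
        have : c = a ∨ c = b := by simpa using (mem_res.1 hc).2
        clear hpair e₁ e₂ e₃ key hmul
        tauto)
  simp only [List.append_assoc, List.cons_append, List.nil_append] at e₁ e₂ e₃ e₄ hpair ⊢
  rw [e₁, e₂, e₃, e₄] at hpair
  exact hpair

end swap

end Base

namespace Base
variable {M : Type u} [Monoid M] (hM : Base M) (φ : ℕ → M)
include hM

section swap
variable {a b : ℕ} {P B r : List ℕ}
  (hmul : ∀ c, c = a ∨ c = b ∨ c ∈ B →
    2 ≤ P.count c + [a].count c + [b].count c + B.count c + r.count c)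
  {w B' : List ℕ} (hab : a ≠ b)
  (hpair : ev φ (P ++ (res {a, b} P ++ [b, a] ++ res {a, b} B) ++ B ++ r) =
    ev φ (P ++ (res {a, b} w ++ [a] ++ res {a, b} B') ++ B ++ r))
  (cntA : B.count a = B'.count a)
include hmul hab hpair cntA

/-- The restrictions of `P` and `w` are powers of b, and copies of a coming from the block are
absorbed by `B`. As b occurs in `P`, only its last remaining copy matters: before a on the left of
`hpair`, after a on the right. -/
theorem swap_of_second_right (haP : a ∉ P) (hbP : b ∈ P) (hbB : b ∉ B) (haw : a ∉ w) {k : ℕ}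
    (cntB : B'.count b = k + 1) :
    ev φ (P ++ [b, a] ++ B ++ r) = ev φ (P ++ [a, b] ++ B ++ r) := by
  have hn : a ∈ B ∨ B.count a = 0 := by
    by_cases haB : a ∈ B
    · exact Or.inl haB
    · exact Or.inr (List.count_eq_zero_of_not_mem haB)
  have key : ∀ X : List ℕ, (∀ c, P.count c + [a].count c + [b].count c + B.count c + r.count c ≤
      X.count c) → ∀ c, c = a ∨ c = b ∨ c ∈ B → 2 ≤ X.count c :=
    fun X hX c hc => (hmul c hc).trans (hX c)
  have hres : ∀ l : List ℕ, ∀ c ∈ res {a, b} l, c = a ∨ c = b := fun l c hc => by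
    simpa using (mem_res.1 hc).2
  have e₁ := hM.absorb_replicate φ (Q := P ++ res {a, b} P ++ [b, a]) (B := B) (r := r) (z := a)
    (B.count a) (by simp) hn fun c hc => key _ (fun c => by
      simp only [List.count_append, List.count_cons, List.count_nil]
      omega) c (Or.inr (Or.inr hc))
  have e₂ := hM.erase φ (Q := P) (m := res {a, b} P) (m' := []) (R := [a] ++ B ++ r) hbP
    (by rw [filter_res_right hab, List.count_eq_zero_of_not_mem haP]; rfl)
    fun c hc => key _ (fun c => by
      simp only [List.count_append, List.count_cons, List.count_nil]
      omega) c ((hres _ c hc).elim Or.inl fun h => Or.inr (Or.inl h))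
  have e₃ : ev φ (P ++ (res {a, b} w ++ [a] ++ res {a, b} B') ++ B ++ r) =
      ev φ (P ++ (res {a, b} w ++ [a] ++ List.replicate (B'.count b) b) ++ B ++ r) := by
    by_cases haB : a ∈ B
    · have := hM.delete_block φ (P := P ++ res {a, b} w ++ [a]) (B := B) (r := r) (by simp) haB
        (filter_res_left hab B') fun c hc => key _ (fun c => by
          rw [cntB, List.replicate_succ]
          simp only [List.count_append, List.count_cons, List.count_nil]
          omega) c (by
            rcases List.mem_append.1 hc with h | h
            · exact (hres _ c h).elim Or.inl fun h => Or.inr (Or.inl h)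
            · exact Or.inr (Or.inr h))
      simpa using this
    · rw [res_of_notMem_left hab B' fun h => haB ?_]
      rwa [← List.count_pos_iff, cntA, List.count_pos_iff]
  have e₄ := hM.erase φ (Q := P) (m := res {a, b} w ++ [a] ++ List.replicate k b) (m' := [a])
    (R := B ++ r) hbP
    (by rw [List.filter_append, List.filter_append, filter_res_right hab,
          List.count_eq_zero_of_not_mem haw]
        simp [hab])
    fun c hc => key _ (fun c => by
      simp only [List.count_append, List.count_cons, List.count_nil]
      omega) c (by
        rcases List.mem_append.1 hc with h | h
        · rcases List.mem_append.1 h with h | h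
          · exact (hres _ c h).elim Or.inl fun h => Or.inr (Or.inl h)
          · exact Or.inl (by simpa using h)
        · exact Or.inr (Or.inl (List.eq_of_mem_replicate h)))
  rw [e₃, res_of_notMem_right hab B hbB, cntB, List.replicate_succ'] at hpair
  simp only [List.append_assoc, List.cons_append, List.nil_append] at e₁ e₂ e₄ hpair ⊢
  rw [e₁, e₂, e₄] at hpair
  exact hpair

/-- The restrictions of `P` and `w` are empty, so `hpair` starts with ba against a. At most one of
the letters lies in `B`, and `B` absorbs its superfluous copies; the single extra b of `B'` supplies
the missing letter. -/
theorem swap_of_neither (haP : a ∉ P) (hbP : b ∉ P) (haw : a ∉ w) (hbw : b ∉ w)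
    (cntB : B'.count b = B.count b + 1) (hB : a ∉ B ∨ b ∉ B) :
    ev φ (P ++ [b, a] ++ B ++ r) = ev φ (P ++ [a, b] ++ B ++ r) := by
  have key : ∀ X : List ℕ, (∀ c, P.count c + [a].count c + [b].count c + B.count c + r.count c ≤
      X.count c) → ∀ c, c = a ∨ c = b ∨ c ∈ B → 2 ≤ X.count c :=
    fun X hX c hc => (hmul c hc).trans (hX c)
  have hnil : ∀ l : List ℕ, a ∉ l → b ∉ l → res {a, b} l = [] := fun l h₁ h₂ => by
    rw [res_of_notMem_left hab l h₁, List.count_eq_zero_of_not_mem h₂]; rfl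
  rw [hnil P haP hbP, hnil w haw hbw] at hpair
  have habs : ∀ (Q : List ℕ) (z : ℕ), z ∈ Q →
      (∀ c, P.count c + [a].count c + [b].count c ≤ Q.count c) →
      ev φ (Q ++ List.replicate (B.count z) z ++ B ++ r) = ev φ (Q ++ B ++ r) := by
    intro Q z hz hQ
    refine hM.absorb_replicate φ (B.count z) hz ?_ fun c hc => key _ (fun c => ?_) c
      (Or.inr (Or.inr hc))
    · by_cases h : z ∈ B
      · exact Or.inl h
      · exact Or.inr (List.count_eq_zero_of_not_mem h)
    · have := hQ c
      simp only [List.count_append]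
      omega
  by_cases haB : a ∈ B
  · have hbB : b ∉ B := hB.resolve_left (not_not.2 haB)
    rw [List.count_eq_zero_of_not_mem hbB] at cntB
    have e₁ := habs (P ++ [b, a]) a (by simp) fun c => by
      simp only [List.count_append, List.count_cons, List.count_nil]
      omega
    have e₂ := hM.delete_block φ (P := P ++ [a]) (B := B) (r := r) (by simp) haB
      (filter_res_left hab B') fun c hc => key _ (fun c => by
        rw [cntB]
        simp only [List.count_append, List.replicate_succ, List.replicate_zero]
        omega) c (by
          rcases List.mem_append.1 hc with h | h
          · have : c = a ∨ c = b := by simpa using (mem_res.1 h).2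
            exact this.elim Or.inl fun h => Or.inr (Or.inl h)
          · exact Or.inr (Or.inr h))
    rw [res_of_notMem_right hab B hbB] at hpair
    rw [cntB] at e₂
    simp only [List.append_assoc, List.cons_append, List.nil_append, List.replicate_succ,
      List.replicate_zero] at e₁ e₂ hpair ⊢
    rw [e₁, e₂] at hpair
    exact hpair
  · have haB' : a ∉ B' := fun h => haB (by
      rwa [← List.count_pos_iff, cntA, List.count_pos_iff])
    rw [res_of_notMem_left hab B haB, res_of_notMem_left hab B' haB', cntB,
      List.replicate_succ] at hpair
    have e₁ := habs (P ++ [b, a]) b (by simp) fun c => by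
      simp only [List.count_append, List.count_cons, List.count_nil]
      omega
    have e₂ := habs (P ++ [a, b]) b (by simp) fun c => by
      simp only [List.count_append, List.count_cons, List.count_nil]
      omega
    simp only [List.append_assoc, List.cons_append, List.nil_append] at e₁ e₂ hpair ⊢
    rw [e₁, e₂] at hpair
    exact hpair

end swap

end Base

namespace Approx
variable {V W : MonoidClass.{u}} (hVW : Approx V W)
include hVW

/-- Two adjacent letters of a block may be interchanged if one of them comes first on the other
side of the identity. -/
theorem swap {T : Finset ℕ} {w s r v' : List ℕ} {a b : ℕ}
    (h : Linked V T (w ++ s ++ b :: a :: r) (w ++ a :: v'))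
    (hA : ∀ z, res (insert z T) (w ++ s ++ b :: a :: r) = res (insert z T) (w ++ a :: v'))
    (hab : a ≠ b) (ha : a ∉ T) (hb : b ∉ T) (has : a ∉ s) (hsT : ∀ c ∈ s, c ∉ T) :
    Holds W (w ++ s ++ b :: a :: r) (w ++ s ++ a :: b :: r) := by
  intro M _ hM φ
  have B₀ := hVW.base M hM
  obtain ⟨B, r, rfl, hB, hr⟩ := res_insert_eq_nil_or (A := T) r
  obtain ⟨B', r', rfl, hB', hr'⟩ := res_insert_eq_nil_or (A := T) v'
  have hBT : ∀ c ∈ B, c ∉ T := fun c hc hcT => by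
    have : c ∈ res T B := mem_res.2 ⟨hc, hcT⟩
    simp [hB] at this
  have hBT' : ∀ c ∈ B', c ∉ T := fun c hc hcT => by
    have : c ∈ res T B' := mem_res.2 ⟨hc, hcT⟩
    simp [hB'] at this
  have hr₁ : r = [] ∨ ∃ t r₁, t ∈ T ∧ r = t :: r₁ := by
    rcases hr with h | ⟨t, r₁, h, h'⟩
    · exact Or.inl h
    · exact Or.inr ⟨t, r₁, h', h⟩
  have hr₁' : r' = [] ∨ ∃ t r₁, t ∈ T ∧ r' = t :: r₁ := by
    rcases hr' with h | ⟨t, r₁, h, h'⟩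
    · exact Or.inl h
    · exact Or.inr ⟨t, r₁, h', h⟩
  have resHead : ∀ {r : List ℕ} (z : ℕ), (r = [] ∨ ∃ t r₁, t ∈ T ∧ r = t :: r₁) →
      (res (insert z T) r = [] ∨ ∃ t r₁, t ∈ T ∧ res (insert z T) r = t :: r₁) := by
    rintro r z (rfl | ⟨t, r₁, ht, rfl⟩)
    · exact Or.inl rfl
    · exact Or.inr ⟨t, res (insert z T) r₁, ht, res_cons_of_mem (by simp [ht]) _⟩
  -- Simple letters delimit the blocks, so the alignment of whole words passes to the current block
  -- and to the remainder separately.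
  have blocks : ∀ z, res (insert z T) (s ++ b :: a :: B) = res (insert z T) (a :: B') ∧
      res (insert z T) r = res (insert z T) r' := by
    intro z
    have e := hA z
    rw [show w ++ s ++ b :: a :: (B ++ r) = w ++ ((s ++ b :: a :: B) ++ r) by simp,
      show w ++ a :: (B' ++ r') = w ++ ((a :: B') ++ r') by simp, res_append, res_append _ w,
      res_append _ (s ++ b :: a :: B), res_append _ (a :: B')] at e
    have e := List.append_cancel_left e
    refine append_inj_of_block (T := T) ?_ ?_ (resHead z hr₁) (resHead z hr₁') e
    · intro c hc
      have hc := (mem_res.1 hc).1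
      simp only [List.mem_append, List.mem_cons] at hc
      rcases hc with hc | rfl | rfl | hc
      exacts [hsT c hc, hb, ha, hBT c hc]
    · intro c hc
      have hc := (mem_res.1 hc).1
      simp only [List.mem_cons] at hc
      rcases hc with rfl | hc
      exacts [ha, hBT' c hc]
  have hcount : ∀ z, (s ++ b :: a :: B).count z = (a :: B').count z := fun z => by
    rw [← count_res (Finset.mem_insert_self z T), (blocks z).1,
      count_res (Finset.mem_insert_self z T)]
  have cntA : B.count a = B'.count a := by
    have := hcount a
    rw [List.count_append, List.count_eq_zero_of_not_mem has,
      List.count_cons_of_ne hab.symm, List.count_cons_self, List.count_cons_self] at this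
    omega
  have cntB : s.count b + 1 + B.count b = B'.count b := by
    have := hcount b
    rw [List.count_append, List.count_cons_self, List.count_cons_of_ne hab,
      List.count_cons_of_ne hab] at this
    omega
  have hUc : ∀ z, (w ++ s ++ b :: a :: (B ++ r)).count z =
      (w ++ s).count z + [a].count z + [b].count z + B.count z + r.count z := by
    intro z
    simp only [List.count_append, List.count_cons, List.count_nil]
    omega
  have hmul : ∀ c, c = a ∨ c = b ∨ c ∈ B →
      2 ≤ (w ++ s).count c + [a].count c + [b].count c + B.count c + r.count c := by
    intro c hc
    rw [← hUc]
    rcases hc with rfl | rfl | hc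
    · exact h.repeated_left c (by simp) ha
    · exact h.repeated_left c (by simp) hb
    · exact h.repeated_left c (by simp [hc]) (hBT c hc)
  -- The cut is made at the end of the current block, where the counts of a and b on the two sides
  -- agree; `w ++ s` is the prefix to multiply by.
  have pair := hVW.pair (p := w ++ s ++ b :: a :: B) (q := w ++ a :: B') (r := r) (r' := r')
    (T := T) (by simpa using h) hab ha hb (blocks a).2 (blocks b).2 hr₁ hr₁' (by simp) (by simp)
    (by
      have := hcount a
      simp only [List.append_assoc, List.count_append] at this ⊢
      omega)
    (by
      have := hcount b
      simp only [List.append_assoc, List.count_append] at this ⊢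
      omega) M hM φ (w ++ s) B (by
      intro z hz hzT hza hzb
      have := h.repeated_left z (by simp [hz]) hzT
      rw [hUc] at this
      simp only [List.count_append]
      simp [hza.symm, hzb.symm] at this
      omega)
  have resP : res {a, b} (w ++ s ++ b :: a :: B) =
      res {a, b} (w ++ s) ++ [b, a] ++ res {a, b} B := by
    rw [res_append, res_cons_of_mem (by simp), res_cons_of_mem (by simp)]
    simp
  have resw : res {a, b} (w ++ a :: B') = res {a, b} w ++ [a] ++ res {a, b} B' := by
    rw [res_append, res_cons_of_mem (by simp)]
    simp
  rw [resP, resw] at pair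
  have haw : a ∉ w ++ s → a ∉ w := fun h₁ h₂ => h₁ (by simp [h₂])
  have hbw : b ∉ w ++ s → b ∉ w := fun h₁ h₂ => h₁ (by simp [h₂])
  have hcb : b ∉ w ++ s → B'.count b = B.count b + 1 := fun h₁ => by
    have : s.count b = 0 := List.count_eq_zero_of_not_mem fun h₂ => h₁ (by simp [h₂])
    omega
  have hcb' : B'.count b = (s.count b + B.count b) + 1 := by omega
  have goal_iff : ∀ c d : ℕ, ev φ (w ++ s ++ c :: d :: (B ++ r)) =
      ev φ (w ++ s ++ [c, d] ++ B ++ r) := by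
    intro c d; simp
  rw [goal_iff, goal_iff]
  clear goal_iff blocks resHead hr hr' hr₁ hr₁' hUc hA h hcount resP resw
  generalize w ++ s = P at *
  by_cases haP : a ∈ P
  · by_cases hbP : b ∈ P
    · have := B₀.comm (has_ev φ haP) (has_ev φ hbP)
      simp only [ev_append, ev_cons, ev_nil, mul_one, ← mul_assoc, this]
    by_cases haB : a ∈ B
    · refine (B₀.swap_of_recur φ (a := b) (b := a) (fun c hc => ?_) haP haB).symm
      have := hmul c (by rcases hc with h | h | h <;> simp [h])
      omega
    · exact B₀.swap_of_first_right φ hmul hab pair cntA haP hbP haB (hbw hbP) (hcb hbP)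
  · by_cases hbP : b ∈ P
    · by_cases hbB : b ∈ B
      · exact B₀.swap_of_recur φ hmul hbP hbB
      · exact B₀.swap_of_second_right φ hmul hab pair cntA haP hbP hbB (haw haP) hcb'
    · by_cases hB₁ : a ∉ B ∨ b ∉ B
      · exact B₀.swap_of_neither φ hmul hab pair cntA haP hbP (haw haP) (hbw hbP) (hcb hbP) hB₁
      · rw [not_or, not_not, not_not] at hB₁
        exact B₀.swap_of_both φ hmul hB₁.1 hB₁.2

end Approx

/-! ### Sorting one side of an aligned identity into the other -/

theorem Linked.of_left {V : MonoidClass.{u}} {T : Finset ℕ} {u u' v : List ℕ}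
    (h : Linked V T u v) (hu : Holds V u u') (hc : ∀ z, u'.count z = u.count z) :
    Linked V T u' v where
  holds := hu.symm.trans h.holds
  simple_left t ht := by rw [hc, h.simple_left t ht]
  simple_right := h.simple_right
  repeated_left z hz hzT := by
    rw [hc]
    refine h.repeated_left z ?_ hzT
    rwa [← List.count_pos_iff, ← hc, List.count_pos_iff]
  repeated_right := h.repeated_right

namespace Approx
variable {V W : MonoidClass.{u}} (hVW : Approx V W)
include hVW

/-- The letter a is swapped leftwards past one letter of s at a time. Alignment survives each swap,
since a restriction to z and the simple letters sees at most one of the two distinct repeated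
letters. -/
theorem move {T : Finset ℕ} {w s r v' : List ℕ} {a : ℕ}
    (h : Linked V T (w ++ s ++ a :: r) (w ++ a :: v'))
    (hA : ∀ z, res (insert z T) (w ++ s ++ a :: r) = res (insert z T) (w ++ a :: v'))
    (ha : a ∉ T) (has : a ∉ s) (hsT : ∀ c ∈ s, c ∉ T) :
    Holds W (w ++ s ++ a :: r) (w ++ a :: (s ++ r)) := by
  induction s using List.reverseRecOn generalizing r with
  | nil => intro M _ _ φ; simp
  | append_singleton s b ih =>
    have hab : a ≠ b := fun e => has (by simp [e])
    have hb : b ∉ T := hsT b (by simp)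
    have has' : a ∉ s := fun h => has (by simp [h])
    have hsT' : ∀ c ∈ s, c ∉ T := fun c hc => hsT c (by simp [hc])
    have assoc : w ++ (s ++ [b]) ++ a :: r = w ++ s ++ b :: a :: r := by simp
    rw [assoc] at h hA ⊢
    have h₁ := hVW.swap h hA hab ha hb has' hsT'
    have h₂ := ih (r := b :: r)
      (h.of_left (hVW.holds_le h₁) fun z => by
        simp only [List.count_append, List.count_cons]; omega)
      (fun z => by
        rw [← hA z, res_append, res_append _ (w ++ s) (b :: a :: r)]
        congr 1
        by_cases hz : a = z
        · have hbz : b ∉ insert z T := by simp [← hz, hab.symm, hb]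
          rw [hz, res_cons_of_mem (by simp), res_cons_of_notMem hbz, res_cons_of_notMem hbz,
            res_cons_of_mem (by simp)]
        · have haz : a ∉ insert z T := by simp [hz, ha]
          rw [res_cons_of_notMem haz]
          by_cases hbz : b ∈ insert z T
          · rw [res_cons_of_mem hbz, res_cons_of_mem hbz, res_cons_of_notMem haz]
          · rw [res_cons_of_notMem hbz, res_cons_of_notMem hbz, res_cons_of_notMem haz])
      has' hsT'
    have h₃ := h₁.trans h₂
    simpa using h₃

/-- A selection sort: `w` is the common prefix already produced, and the next letter of `v'` is
brought to the front of `u'`. -/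
theorem holds_of_aligned {T : Finset ℕ} {w u' v' : List ℕ} (h : Linked V T (w ++ u') (w ++ v'))
    (hA : ∀ z, res (insert z T) (w ++ u') = res (insert z T) (w ++ v')) :
    Holds W (w ++ u') (w ++ v') := by
  have hA' : ∀ z, res (insert z T) u' = res (insert z T) v' := fun z => by
    have := hA z
    rw [res_append, res_append] at this
    exact List.append_cancel_left this
  induction v' generalizing w u' with
  | nil =>
    cases u' with
    | nil => intro M _ _ φ; rfl
    | cons c u' =>
      have := hA' c
      rw [res_cons_of_mem (by simp)] at this
      simp at this
  | cons a v' ih =>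
    by_cases ha : a ∈ T
    · cases u' with
      | nil =>
        have := hA' a
        rw [res_cons_of_mem (by simp)] at this
        simp at this
      | cons c u' =>
        have := hA' c
        rw [res_cons_of_mem (by simp), res_cons_of_mem (by simp [ha]), List.cons.injEq] at this
        obtain rfl := this.1
        have := ih (w := w ++ [c]) (u' := u') (by simpa using h)
          (fun z => by simpa using hA z) fun z => by
            have := hA' z
            rwa [res_cons_of_mem (by simp [ha]), res_cons_of_mem (by simp [ha]), List.cons.injEq,
              eq_self_iff_true, true_and] at this
        simpa using this
    · have hau : a ∈ u' := by
        have : a ∈ res (insert a T) u' := by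
          rw [hA' a, res_cons_of_mem (by simp)]
          simp
        exact (mem_res.1 this).1
      obtain ⟨s, r, rfl, has⟩ := List.eq_append_cons_of_mem hau
      -- In the restriction to a and the simple letters the other side starts with a, so no simple
      -- letter can precede the first a of `u'`; that a lies in the current block.
      have hsT : ∀ c ∈ s, c ∉ T := by
        intro c hc hcT
        have e := hA' a
        rw [res_append, res_cons_of_mem (l := v') (by simp)] at e
        cases hs : res (insert a T) s with
        | nil =>
          have : c ∈ res (insert a T) s := mem_res.2 ⟨hc, by simp [hcT]⟩
          simp [hs] at this
        | cons d l =>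
          rw [hs, List.cons_append, List.cons.injEq] at e
          have : d ∈ res (insert a T) s := by simp [hs]
          exact has (e.1 ▸ (mem_res.1 this).1)
      rw [← List.append_assoc] at h hA ⊢
      have h₁ := hVW.move h hA ha has hsT
      have hLink := h.of_left (hVW.holds_le h₁) fun z => by
        simp only [List.count_append, List.count_cons]; omega
      have key : ∀ z, res (insert z T) (s ++ r) = res (insert z T) v' := by
        intro z
        have e := hA' z
        rw [res_append] at e ⊢
        by_cases hz : a = z
        · subst hz
          have hs : res (insert a T) s = [] := by
            rw [res_eq_nil]
            intro c hc
            simp only [Finset.mem_insert, not_or]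
            exact ⟨fun e => has (e ▸ hc), hsT c hc⟩
          rw [hs, res_cons_of_mem (by simp), res_cons_of_mem (by simp)] at e
          rw [hs]
          exact (List.cons.inj e).2
        · have haz : a ∉ insert z T := by simp [hz, ha]
          rwa [res_cons_of_notMem haz, res_cons_of_notMem haz] at e
      have h₂ := ih (w := w ++ [a]) (u' := s ++ r) (by simpa using hLink)
        (fun z => by rw [res_append, res_append _ (w ++ [a]) v', key z]) key
      refine h₁.trans ?_
      simpa using h₂

theorem holds_of_holds {u v : List ℕ} (h : Holds V u v) : Holds W u v := by
  let T := u.toFinset.filter fun z => u.count z = 1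
  have hT : ∀ z, z ∈ T ↔ u.count z = 1 := by
    intro z
    simp only [T, Finset.mem_filter, List.mem_toFinset, and_iff_right_iff_imp]
    intro hz
    exact List.count_pos_iff.1 (by omega)
  have hlink : Linked V T u v := by
    refine ⟨h, fun t ht => (hT t).1 ht, fun t ht => ?_, fun z hz hzT => ?_, fun z hz hzT => ?_⟩
    · have := (hT t).1 ht
      rcases hVW.count_iff h t with h | h <;> omega
    · have := List.count_pos_iff.2 hz
      rw [hT] at hzT
      omega
    · have := List.count_pos_iff.2 hz
      rw [hT] at hzT
      rcases hVW.count_iff h z with h | h <;> omega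
  obtain ⟨u₀, v₀, h₁, h₂, h₃, h₄⟩ := hVW.align hlink
  have := hVW.holds_of_aligned (w := []) (by simpa using h₃) (by simpa using h₄)
  exact h₁.trans (Holds.trans (by simpa using this) h₂.symm)

end Approx

/-! ### The class defined by the restricted identities, and the conclusion -/

theorem toList_altTail (s m : ℕ) : FreeMonoid.toList (altTail s m) = altList s m := by
  unfold altTail altList
  induction m generalizing s with
  | zero => rfl
  | succ m ih =>
    rw [List.range'_succ, List.map_cons, List.prod_cons, FreeMonoid.toList_mul, ih,
      List.flatMap_cons]
    congr 1
    by_cases h : Odd s <;> simp [ti, altLetter, h, x, y]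

theorem ofList_altList_mem_tails {s m : ℕ} (hs : s = 1 ∨ s = 2) :
    FreeMonoid.ofList (altList s m) ∈ tails := by
  rcases Nat.eq_zero_or_pos m with rfl | hm
  · exact Or.inl (Or.inl rfl)
  · refine Or.inr ⟨m, hm, ?_⟩
    rcases hs with rfl | rfl
    · exact Or.inl (by rw [← toList_altTail]; rfl)
    · exact Or.inr (by rw [← toList_altTail]; rfl)

theorem IsTail.ofList_mem_tails {c : List ℕ} (hc : IsTail c) : FreeMonoid.ofList c ∈ tails := by
  rcases hc with rfl | ⟨s, m, hs, rfl⟩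
  · exact Or.inl (Or.inr rfl)
  · exact ofList_altList_mem_tails hs

theorem Base.of_satisfies {M : Type u} [Monoid M] (hO : varO M) (hJ : Satisfies M (evComm 2)) :
    Base M where
  left a c b d := by
    have := hO _ (Or.inl rfl) fun i => if i = 0 then a else if i = 1 then b else if i = 2 then c
      else d
    simpa [x, y, h, t] using this
  right a c b d := by
    have := hO _ (Or.inr rfl) fun i => if i = 0 then a else if i = 1 then b else if i = 2 then c
      else d
    simpa [x, y, h, t] using this
  sq_comm a b := by
    have := hJ fun i => if i = 0 then a else b
    simpa [evComm, x, y, pow_two] using this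

theorem satisfies_iff_id₁ (M : Type u) [Monoid M] :
    Satisfies M (x * h * x, h * x ^ 2) ↔ Id₁ M := by
  constructor
  · intro H a b
    simpa [x, h, pow_two, mul_assoc] using H fun i => if i = 0 then a else b
  · intro H φ
    simpa [x, h, pow_two, mul_assoc] using H (φ 0) (φ 2)

theorem satisfies_iff_id₂ (M : Type u) [Monoid M] :
    Satisfies M (x ^ 2 * h * x, x ^ 2 * h) ↔ Id₂ M := by
  constructor
  · intro H a b
    simpa [x, h, pow_two, mul_assoc] using H fun i => if i = 0 then a else b
  · intro H φ
    simpa [x, h, pow_two, mul_assoc] using H (φ 0) (φ 2)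

theorem satisfies_iff_id₃ (M : Type u) [Monoid M] :
    Satisfies M (x ^ 2 * h * x * t * x, x ^ 2 * h * t * x) ↔ Id₃ M := by
  constructor
  · intro H a b c
    simpa [x, h, t, pow_two, mul_assoc] using
      H fun i => if i = 0 then a else if i = 2 then b else c
  · intro H φ
    simpa [x, h, t, pow_two, mul_assoc] using H (φ 0) (φ 2) (φ 3)

theorem satisfies_iff_id₄ (M : Type u) [Monoid M] :
    Satisfies M (x ^ 2 * h * x, x * h * x) ↔ Id₄ M := by
  constructor
  · intro H a b
    simpa [x, h, pow_two, mul_assoc] using H fun i => if i = 0 then a else b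
  · intro H φ
    simpa [x, h, pow_two, mul_assoc] using H (φ 0) (φ 2)

/-- The identities of `S` that hold in `V`. -/
def identitiesIn (V : MonoidClass.{u}) (S : Set MIdentity) : Set MIdentity :=
  {σ ∈ S | ∀ (M : Type u) [Monoid M], V M → Satisfies M σ}

/-- The variety defined by the identities of the restricted forms that hold in `V`. -/
def restricted (V : MonoidClass.{u}) : MonoidClass.{u} :=
  varOf (idsO ∪ {aper 2, evComm 2} ∪ identitiesIn V idsFour ∪ identitiesIn V idsTail)

theorem approx_restricted {V : MonoidClass.{u}}
    (hsub : ∀ (M : Type u) [Monoid M], V M → varO M ∧ varJ 2 M) (hnc : ¬ IsCommutative V) :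
    Approx V (restricted V) where
  base M _ hM := Base.of_satisfies (fun σ hσ => hM σ (Or.inl (Or.inl (Or.inl hσ))))
    (hM _ (Or.inl (Or.inl (Or.inr (Or.inr rfl)))))
  le M _ hM σ hσ := by
    rcases hσ with ((hσ | hσ) | hσ) | hσ
    exacts [(hsub M hM).1 σ hσ, (hsub M hM).2 σ hσ, hσ.2 M hM, hσ.2 M hM]
  id₁ H M _ hM := (satisfies_iff_id₁ M).1 <| hM _ <| Or.inl <| Or.inr
    ⟨Or.inl rfl, fun N _ hN => (satisfies_iff_id₁ N).2 (H N hN)⟩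
  id₂ H M _ hM := (satisfies_iff_id₂ M).1 <| hM _ <| Or.inl <| Or.inr
    ⟨Or.inr (Or.inl rfl), fun N _ hN => (satisfies_iff_id₂ N).2 (H N hN)⟩
  id₃ H M _ hM := (satisfies_iff_id₃ M).1 <| hM _ <| Or.inl <| Or.inr
    ⟨Or.inr (Or.inr (Or.inl rfl)), fun N _ hN => (satisfies_iff_id₃ N).2 (H N hN)⟩
  id₄ H M _ hM := (satisfies_iff_id₄ M).1 <| hM _ <| Or.inl <| Or.inr
    ⟨Or.inr (Or.inr (Or.inr rfl)), fun N _ hN => (satisfies_iff_id₄ N).2 (H N hN)⟩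
  tail p q c hp hq hc hcount H := by
    have hx := hcount 0 (Or.inl rfl)
    have hy := hcount 1 (Or.inr rfl)
    have hne : ∀ l : List ℕ, 1 ≤ l.count 0 → FreeMonoid.ofList l ≠ 1 := by
      rintro l hl e
      obtain rfl : l = [] := e
      simp at hl
    -- Only the head 1 is used.
    let σ : MIdentity := (1 * FreeMonoid.ofList p * FreeMonoid.ofList c,
      1 * FreeMonoid.ofList q * FreeMonoid.ofList c)
    refine (holds_iff (restricted V) σ).1 fun M _ hM => hM σ (Or.inr ⟨?_, (holds_iff V σ).2 H⟩)
    refine ⟨1, FreeMonoid.ofList p, FreeMonoid.ofList q, FreeMonoid.ofList c, Or.inl rfl,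
      ⟨hne p hx.1, hp⟩, ⟨hne q (hx.2.1 ▸ hx.1), hq⟩, hc.ofList_mem_tails, ?_, ?_, ?_, ?_, rfl⟩
    · exact ⟨hx.1, hx.2.1, hx.2.2.1⟩
    · exact ⟨hy.1, hy.2.1, hy.2.2.1⟩
    · refine ⟨?_, hx.2.2.2⟩
      change (p ++ c).count 0 = (q ++ c).count 0
      rw [List.count_append, List.count_append, hx.2.1]
    · refine ⟨?_, hy.2.2.2⟩
      change (p ++ c).count 1 = (q ++ c).count 1
      rw [List.count_append, List.count_append, hy.2.1]
  noncomm H := hnc fun M _ hM a b => by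
    simpa using H M hM fun i => if i = 0 then a else b

end MonoidVar

theorem mainTheorem5 (V : MonoidVar.MonoidClass.{u}) (hV : MonoidVar.IsVariety V)
    (hsub : ∀ (M : Type u) [Monoid M], V M → MonoidVar.varO M ∧ MonoidVar.varJ 2 M)
    (hnc : ¬ MonoidVar.IsCommutative V) :
    ∃ S₁ S₂ : Set MonoidVar.MIdentity, S₁ ⊆ MonoidVar.idsFour ∧ S₂ ⊆ MonoidVar.idsTail ∧
      ∀ (M : Type u) [Monoid M],
        V M ↔ MonoidVar.varOf
          (MonoidVar.idsO ∪ {MonoidVar.aper 2, MonoidVar.evComm 2} ∪ S₁ ∪ S₂) M := by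
  have happrox := MonoidVar.approx_restricted hsub hnc
  refine ⟨MonoidVar.identitiesIn V MonoidVar.idsFour, MonoidVar.identitiesIn V MonoidVar.idsTail,
    fun σ hσ => hσ.1, fun σ hσ => hσ.1, fun M _ => ⟨happrox.le M, fun hM => ?_⟩⟩
  exact hV.mem_of_identities M fun a b hab => happrox.holds_of_holds hab M hM
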